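/- **Setting.** Fix an integer $q\ge 0$ and an inverse temperature $\beta\ge 0$. Consider a chain of $n$ sites, $\mathcal H=(\mathbb C^{2^q})^{\otimes n}$, with a nearest-neighbour Hamiltonian with open boundary conditions $H=\sum_{b=1}^{n-1}H_{b,b+1}$, where each $H_{b,b+1}$ is Hermitian, acts on the sites $b,b+1$, and satisfies $\|H_{b,b+1}\|\le 1$. Let $\rho=e^{-\beta H}/\mathrm{Tr}[e^{-\beta H}]$, $\langle X,Y\rangle_\rho=\mathrm{Tr}[X^\dagger\rho^{1/2}Y\rho^{1/2}]$ and $\|X\|_\rho^2=\langle X,X\rangle_\rho$. For $R\subseteq[n]$ let - $\tilde{\mathbb E}_R$ be the orthogonal projection, with respect to $\langle\cdot,\cdot\rangle_\rho$, onto the operators supported on $[n]\setminus R$, i.e. $\tilde{\mathbb E}_R[Y]=\sum_i\langle B^i,Y\rangle_\rho B^i$ for any $\langle\cdot,\cdot\rangle_\rho$-orthonormal basis $\{B^i\}$ of that space; - $\mathsf{Var}_R(X)=\|X-\tilde{\mathbb E}_R[X]\|_\rho^2$ and $\mathsf{Cov}_R(X,Y)=\langle(1-\tilde{\mathbb E}_R)[X],(1-\tilde{\mathbb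 E}_R)[Y]\rangle_\rho$; - $\mathcal K_R=\sum_a\mathcal K_a$, the sum over all single-site Pauli strings $A^a$ ($q$-fold tensor products of $I,X,Y,Z$ on one site of $R$), where $\mathcal K_a[X]=[A^a,X]\,(\rho^{1/2}A^{a\dagger}\rho^{-1/2})-(\rho^{-1/2}A^{a\dagger}\rho^{1/2})\,[A^a,X]$; - $\lambda_R=\inf\big\{\langle O,-\mathcal K_R[O]\rangle_\rho/\mathsf{Var}_R(O): O\in\mathcal B(\mathcal H),\ \mathsf{Var}_R(O)\neq 0\big\}$, the conditional spectral gap of $\mathcal K_R$ (with $\inf\emptyset=+\infty$). An interval is a nonempty set of consecutive sites. **Proposition.** For all $q\ge 0$, $\beta\ge 0$ and constants $c_1,c_2,c_3>0$ there are constants $\ell_0\ge 2$, $\lambda_0>0$, $c>0$, depending only on $\beta,q,c_1,c_2,c_3$ (in particular not on $n$ or $H$), such that the following holds for every $n$ and every $H$ as above. Suppose that strong clustering holds in the form $$\mathrm{Re}\,\mathsf{Cov}_{ABC}\big(\tilde{\mathbb E}_{AB}[O],\tilde{\mathbb E}_{BC}[O]\big)\le\|O\|_\rho^2\cdot c_1\exp\big(-|B|^{c_2}\big)$$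 for all operators $O$ and all disjoint consecutive intervals $A,B,C\subseteq[n]$ with $\tfrac12|A|,\tfrac12|C|\ge|B|\ge c_3|ABC|/\log|ABC|$, where $ABC=A\cup B\cup C$, etc. Then every interval $R\subseteq[n]$ with $|R|\ge\ell_0$ satisfies $$\lambda_R\ge\lambda_0\cdot\frac1{\log^c|R|}.$$ -/

import Mathlib

noncomputable section

namespace SpinChain

open scoped Matrix.Norms.L2Operator ComplexOrder

/-! ### The chain, its operators, and operators supported on a set of sites -/

/-- Basis labels of one site, a qudit of dimension `2 ^ q`, seen as `q` qubits. -/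
abbrev Site (q : ℕ) : Type := Fin q → Fin 2

/-- Product basis labels of the Hilbert space of `n` sites. -/
abbrev Config (n q : ℕ) : Type := Fin n → Site q

/-- Linear operators on the Hilbert space of the chain, as matrices in the product basis. -/
abbrev Op (n q : ℕ) : Type := Matrix (Config n q) (Config n q) ℂ

/-- The embedding `M ↦ M ⊗ I` of the operators on the sites in `S`. -/
def embedOp {n q : ℕ} (S : Finset (Fin n)) :
    Matrix (S → Site q) (S → Site q) ℂ →ₗ[ℂ] Op n q where
  toFun M := Matrix.of fun σ τ =>
    if ∀ i, i ∉ S → σ i = τ i then M (fun i => σ i) (fun i => τ i) else 0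
  map_add' M N := by
    ext σ τ
    simp only [Matrix.of_apply, Matrix.add_apply]
    split_ifs <;> simp
  map_smul' c M := by
    ext σ τ
    simp only [Matrix.of_apply, Matrix.smul_apply, RingHom.id_apply]
    split_ifs <;> simp

/-- The space of operators of the form `M ⊗ I` with `M` acting on the sites in `S`. -/
def localOps {n q : ℕ} (S : Finset (Fin n)) : Submodule ℂ (Op n q) :=
  LinearMap.range (embedOp S)

/-! ### Nearest-neighbour Hamiltonians and their Gibbs states -/

/-- A nearest-neighbour Hamiltonian with open boundary conditions: for every pair of neighbouring
sites `b, b + 1` a Hermitian term that acts on these two sites and has operator norm at most `1`. -/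
structure Hamiltonian1D (n q : ℕ) where
  term : Fin (n - 1) → Op n q
  isHermitian : ∀ b, (term b).IsHermitian
  supported : ∀ b : Fin (n - 1),
    term b ∈ localOps ({⟨b, by omega⟩, ⟨b + 1, by omega⟩} : Finset (Fin n))
  norm_le : ∀ b, ‖term b‖ ≤ 1

variable {n q : ℕ}

/-- The full Hamiltonian. -/
def Hamiltonian1D.total (H : Hamiltonian1D n q) : Op n q := ∑ b, H.term b

/-- The partition function `Tr e^{-β H}` (a positive number, see `gibbs_trace_pos`). -/
def partitionFn (H : Hamiltonian1D n q) (β : ℝ) : ℝ :=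
  (NormedSpace.exp ((-β : ℂ) • H.total)).trace.re

/-- The Gibbs state `ρ = e^{-β H} / Tr e^{-β H}`. -/
def gibbs (H : Hamiltonian1D n q) (β : ℝ) : Op n q :=
  ((NormedSpace.exp ((-β : ℂ) • H.total)).trace)⁻¹ • NormedSpace.exp ((-β : ℂ) • H.total)

/-- The real powers `ρ ^ s = e^{-s β H} / (Tr e^{-β H}) ^ s` of the Gibbs state. The facts
`gibbsPow_one`, `gibbsPow_add` and `gibbsPow_posDef` below show that these are the
powers of the positive definite matrix `ρ`. -/
def gibbsPow (H : Hamiltonian1D n q) (β s : ℝ) : Op n q :=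
  ((partitionFn H β ^ (-s) : ℝ) : ℂ) • NormedSpace.exp ((-(s * β) : ℂ) • H.total)

/-- The KMS inner product `⟨X, Y⟩ = Tr[X† ρ^{1/2} Y ρ^{1/2}]`. -/
def kmsInner (H : Hamiltonian1D n q) (β : ℝ) (X Y : Op n q) : ℂ :=
  (X.conjTranspose * gibbsPow H β (1 / 2) * Y * gibbsPow H β (1 / 2)).trace

/-- The squared KMS norm `‖X‖² = ⟨X, X⟩`. -/
def kmsNormSq (H : Hamiltonian1D n q) (β : ℝ) (X : Op n q) : ℝ := (kmsInner H β X X).re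

/-! ### Basic facts: `ρ ^ s` is positive definite and the KMS form is an inner product -/

theorem Hamiltonian1D.total_isHermitian (H : Hamiltonian1D n q) : H.total.IsHermitian := by
  unfold Hamiltonian1D.total Matrix.IsHermitian
  rw [Matrix.conjTranspose_sum]
  exact Finset.sum_congr rfl fun b _ => H.isHermitian b

theorem smul_total_isHermitian (H : Hamiltonian1D n q) (t : ℝ) :
    ((t : ℂ) • H.total).IsHermitian := by
  unfold Matrix.IsHermitian
  rw [Matrix.conjTranspose_smul, H.total_isHermitian]
  simp

theorem exp_add_total (H : Hamiltonian1D n q) (s t : ℝ) :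
    NormedSpace.exp (((s + t : ℝ) : ℂ) • H.total)
      = NormedSpace.exp ((s : ℂ) • H.total) * NormedSpace.exp ((t : ℂ) • H.total) := by
  rw [← Matrix.exp_add_of_commute]
  · congr 1
    rw [← add_smul]
    push_cast
    rfl
  · exact ((Commute.refl H.total).smul_left _).smul_right _

theorem exp_total_posDef (H : Hamiltonian1D n q) (t : ℝ) :
    (NormedSpace.exp ((t : ℂ) • H.total)).PosDef := by
  have h : NormedSpace.exp ((t : ℂ) • H.total)
      = (NormedSpace.exp (((t / 2 : ℝ) : ℂ) • H.total)).conjTranspose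
        * NormedSpace.exp (((t / 2 : ℝ) : ℂ) • H.total) := by
    rw [← Matrix.exp_conjTranspose, (smul_total_isHermitian H (t / 2)).eq, ← exp_add_total]
    norm_num
  rw [h]
  exact Matrix.PosDef.conjTranspose_mul_self _
    (Matrix.mulVec_injective_of_isUnit (Matrix.isUnit_exp _))

theorem exp_neg_total_posDef (H : Hamiltonian1D n q) (β : ℝ) :
    (NormedSpace.exp ((-β : ℂ) • H.total)).PosDef := by
  have := exp_total_posDef H (-β)
  push_cast at this
  exact this

theorem gibbs_trace_pos (H : Hamiltonian1D n q) (β : ℝ) :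
    0 < partitionFn H β ∧
      (NormedSpace.exp ((-β : ℂ) • H.total)).trace = (partitionFn H β : ℂ) := by
  have h := (exp_neg_total_posDef H β).trace_pos
  rw [Complex.lt_def] at h
  refine ⟨h.1, ?_⟩
  apply Complex.ext
  · simp [partitionFn]
  · simpa using h.2.symm

theorem gibbsPow_posDef (H : Hamiltonian1D n q) (β s : ℝ) : (gibbsPow H β s).PosDef := by
  have h := exp_total_posDef H (-(s * β))
  push_cast at h
  unfold gibbsPow
  apply h.smul
  rw [Complex.zero_lt_real]
  exact Real.rpow_pos_of_pos (gibbs_trace_pos H β).1 _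

theorem gibbsPow_one (H : Hamiltonian1D n q) (β : ℝ) : gibbsPow H β 1 = gibbs H β := by
  unfold gibbsPow gibbs
  rw [(gibbs_trace_pos H β).2, Real.rpow_neg_one]
  push_cast
  rw [one_mul]

theorem gibbsPow_add (H : Hamiltonian1D n q) (β s t : ℝ) :
    gibbsPow H β (s + t) = gibbsPow H β s * gibbsPow H β t := by
  have h := exp_add_total H (-(s * β)) (-(t * β))
  have hz : partitionFn H β ^ (-(s + t)) = partitionFn H β ^ (-s) * partitionFn H β ^ (-t) := by
    rw [← Real.rpow_add (gibbs_trace_pos H β).1]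
    ring_nf
  have he : ((-((s + t : ℝ) * β) : ℂ)) = ((-(s * β) + -(t * β) : ℝ) : ℂ) := by
    push_cast
    ring
  unfold gibbsPow
  rw [Matrix.smul_mul, Matrix.mul_smul, smul_smul, hz, he, h]
  push_cast
  rfl

theorem kmsInner_eq (H : Hamiltonian1D n q) (β : ℝ) (X Y : Op n q) :
    kmsInner H β X Y
      = ((gibbsPow H β (1 / 4) * X * gibbsPow H β (1 / 4)).conjTranspose
          * (gibbsPow H β (1 / 4) * Y * gibbsPow H β (1 / 4))).trace := by
  have h : gibbsPow H β (1 / 2) = gibbsPow H β (1 / 4) * gibbsPow H β (1 / 4) := by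
    rw [← gibbsPow_add]
    norm_num
  unfold kmsInner
  rw [h, Matrix.conjTranspose_mul, Matrix.conjTranspose_mul,
    (gibbsPow_posDef H β (1 / 4)).isHermitian.eq]
  set g := gibbsPow H β (1 / 4)
  calc (X.conjTranspose * (g * g) * Y * (g * g)).trace
      = ((X.conjTranspose * (g * g) * Y * g) * g).trace := by simp only [Matrix.mul_assoc]
    _ = (g * (X.conjTranspose * (g * g) * Y * g)).trace := Matrix.trace_mul_comm _ _
    _ = _ := by simp only [Matrix.mul_assoc]

/-- The space of operators, regarded as a Hilbert space with the KMS inner product. -/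
def KMSSpace (_H : Hamiltonian1D n q) (_β : ℝ) : Type := Op n q

instance (H : Hamiltonian1D n q) (β : ℝ) : AddCommGroup (KMSSpace H β) :=
  inferInstanceAs (AddCommGroup (Op n q))

instance (H : Hamiltonian1D n q) (β : ℝ) : Module ℂ (KMSSpace H β) :=
  inferInstanceAs (Module ℂ (Op n q))

instance (H : Hamiltonian1D n q) (β : ℝ) : FiniteDimensional ℂ (KMSSpace H β) :=
  inferInstanceAs (FiniteDimensional ℂ (Op n q))

/-- The identity map from operators to the KMS Hilbert space. -/
def toKMS (H : Hamiltonian1D n q) (β : ℝ) : Op n q ≃ₗ[ℂ] KMSSpace H β :=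
  LinearEquiv.refl ℂ (Op n q)

/-- The KMS inner product satisfies the axioms of an inner product. -/
@[reducible] def kmsCore (H : Hamiltonian1D n q) (β : ℝ) : InnerProductSpace.Core ℂ (KMSSpace H β) where
  inner X Y := kmsInner H β ((toKMS H β).symm X) ((toKMS H β).symm Y)
  conj_inner_symm X Y := by
    rw [kmsInner_eq, kmsInner_eq, starRingEnd_apply, ← Matrix.trace_conjTranspose,
      Matrix.conjTranspose_mul, Matrix.conjTranspose_conjTranspose]
  re_inner_nonneg X := by
    rw [kmsInner_eq]
    exact (RCLike.nonneg_iff.mp (Matrix.posSemidef_conjTranspose_mul_self _).trace_nonneg).1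
  add_left X Y Z := by
    simp [kmsInner, Matrix.conjTranspose_add, Matrix.add_mul, Matrix.trace_add]
  smul_left X Y r := by
    simp [kmsInner, Matrix.conjTranspose_smul, Matrix.trace_smul]
  definite X h := by
    rw [kmsInner_eq, Matrix.trace_conjTranspose_mul_self_eq_zero_iff] at h
    have hu := (gibbsPow_posDef H β (1 / 4)).isUnit
    rw [hu.mul_left_eq_zero, hu.mul_right_eq_zero] at h
    exact (toKMS H β).symm.map_eq_zero_iff.mp h

instance (H : Hamiltonian1D n q) (β : ℝ) : NormedAddCommGroup (KMSSpace H β) :=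
  (kmsCore H β).toNormedAddCommGroup

instance (H : Hamiltonian1D n q) (β : ℝ) : InnerProductSpace ℂ (KMSSpace H β) :=
  InnerProductSpace.ofCore (kmsCore H β).toCore

theorem inner_toKMS (H : Hamiltonian1D n q) (β : ℝ) (X Y : Op n q) :
    inner ℂ (toKMS H β X) (toKMS H β Y) = kmsInner H β X Y := rfl

/-! ### Spectral conditional expectations, conditional variance and covariance -/

/-- The spectral conditional expectation of the region `R`: the orthogonal projection, for the KMS
inner product, onto the operators supported on the complement of `R`. -/
def condExp (H : Hamiltonian1D n q) (β : ℝ) (R : Finset (Fin n)) : Op n q →ₗ[ℂ] Op n q :=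
  (toKMS H β).symm.toLinearMap ∘ₗ
    (((localOps Rᶜ).map (toKMS H β).toLinearMap).starProjection :
      KMSSpace H β →L[ℂ] KMSSpace H β).toLinearMap ∘ₗ (toKMS H β).toLinearMap

/-- The formula `∑ i, ⟨B i, Y⟩ B i` for any KMS-orthonormal basis `B` of the operators supported
on the complement of `R`. -/
theorem condExp_eq_sum (H : Hamiltonian1D n q) (β : ℝ) (R : Finset (Fin n)) {ι : Type*}
    [Fintype ι] [DecidableEq ι] (B : ι → Op n q)
    (horth : ∀ i j, kmsInner H β (B i) (B j) = if i = j then 1 else 0)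
    (hspan : Submodule.span ℂ (Set.range B) = localOps Rᶜ) (Y : Op n q) :
    condExp H β R Y = ∑ i, kmsInner H β (B i) Y • B i := by
  apply (toKMS H β).injective
  have key : ((localOps Rᶜ).map (toKMS H β).toLinearMap).starProjection (toKMS H β Y)
      = toKMS H β (∑ i, kmsInner H β (B i) Y • B i) := by
    refine Submodule.eq_starProjection_of_mem_of_inner_eq_zero ?_ ?_
    · refine Submodule.mem_map_of_mem ?_
      rw [← hspan]
      exact Submodule.sum_mem _ fun i _ =>
        Submodule.smul_mem _ _ (Submodule.subset_span ⟨i, rfl⟩)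
    · rintro _ ⟨W, hW, rfl⟩
      rw [← hspan] at hW
      have hz : ∀ j, inner ℂ (toKMS H β Y - toKMS H β (∑ i, kmsInner H β (B i) Y • B i))
          (toKMS H β (B j)) = 0 := by
        intro j
        rw [inner_eq_zero_symm, inner_sub_right, map_sum, inner_sum]
        simp [inner_toKMS, horth]
      induction hW using Submodule.span_induction with
      | mem x hx =>
        obtain ⟨j, rfl⟩ := hx
        exact hz j
      | zero => simp
      | add x y _ _ hx hy =>
        rw [map_add, inner_add_right, hx, hy, add_zero]
      | smul a x _ hx =>
        rw [map_smul, inner_smul_right, hx, mul_zero]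
  exact key

/-- The conditional variance `Var_R(X) = ‖X - E_R[X]‖²`. -/
def condVar (H : Hamiltonian1D n q) (β : ℝ) (R : Finset (Fin n)) (X : Op n q) : ℝ :=
  kmsNormSq H β (X - condExp H β R X)

/-- The conditional covariance `Cov_R(X, Y) = ⟨(1 - E_R)[X], (1 - E_R)[Y]⟩`. -/
def condCov (H : Hamiltonian1D n q) (β : ℝ) (R : Finset (Fin n)) (X Y : Op n q) : ℂ :=
  kmsInner H β (X - condExp H β R X) (Y - condExp H β R Y)

/-! ### The generator with single-site Pauli jumps, and its conditional spectral gap -/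

/-- The Pauli matrices `I, X, Y, Z`. -/
def pauli : Fin 4 → Matrix (Fin 2) (Fin 2) ℂ :=
  ![1, !![0, 1; 1, 0], !![0, -Complex.I; Complex.I, 0], !![1, 0; 0, -1]]

/-- The Pauli string `s`, a tensor product of `q` Pauli matrices, acting on the site `i` of the
chain and as the identity on all other sites. -/
def sitePauli (i : Fin n) (s : Fin q → Fin 4) : Op n q :=
  Matrix.of fun σ τ =>
    if ∀ j, j ≠ i → σ j = τ j then ∏ k, pauli (s k) (σ i k) (τ i k) else 0

/-- The generator of one jump operator `A`:
`[A, X] (ρ^{1/2} A† ρ^{-1/2}) - (ρ^{-1/2} A† ρ^{1/2}) [A, X]`. -/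
def jumpGenerator (H : Hamiltonian1D n q) (β : ℝ) (A X : Op n q) : Op n q :=
  (A * X - X * A) * (gibbsPow H β (1 / 2) * A.conjTranspose * gibbsPow H β (-(1 / 2)))
    - (gibbsPow H β (-(1 / 2)) * A.conjTranspose * gibbsPow H β (1 / 2)) * (A * X - X * A)

/-- The generator of the region `R`: the sum over all single-site Pauli strings on sites of `R`. -/
def generator (H : Hamiltonian1D n q) (β : ℝ) (R : Finset (Fin n)) (X : Op n q) : Op n q :=
  ∑ i ∈ R, ∑ s : Fin q → Fin 4, jumpGenerator H β (sitePauli i s) X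

/-- The conditional spectral gap: the infimum of `⟨X, -K_R[X]⟩ / Var_R(X)` over all operators `X`
with `Var_R(X) ≠ 0`. Both forms are real, and the infimum is taken in the extended reals, so that
it is `⊤` when no operator has positive conditional variance. -/
def condGap (H : Hamiltonian1D n q) (β : ℝ) (R : Finset (Fin n)) : EReal :=
  ⨅ (X : Op n q) (_ : condVar H β R X ≠ 0),
    (((kmsInner H β X (-generator H β R X)).re / condVar H β R X : ℝ) : EReal)

/-! ### Intervals and strong clustering -/

/-- The sites `a, a + 1, …, b - 1` of the chain (numbered from `0`). -/
def interval (n a b : ℕ) : Finset (Fin n) := {i | a ≤ (i : ℕ) ∧ (i : ℕ) < b}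

/-- A nonempty set of consecutive sites. -/
def IsInterval (R : Finset (Fin n)) : Prop := ∃ a b : ℕ, a < b ∧ b ≤ n ∧ R = interval n a b

/-- Strong clustering with error `c₁ exp(-|B|^{c₂})` over all consecutive disjoint nonempty
intervals `A, B, C` with `|A| / 2, |C| / 2 ≥ |B| ≥ c₃ |ABC| / log |ABC|`. The covariance is a
complex number, and only its real part is required to be small. -/
def StrongClustering (H : Hamiltonian1D n q) (β c₁ c₂ c₃ : ℝ) : Prop :=
  ∀ x y z w : ℕ, x < y → y < z → z < w → w ≤ n →
    ∀ A B C : Finset (Fin n), A = interval n x y → B = interval n y z → C = interval n z w →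
      (B.card : ℝ) ≤ (A.card : ℝ) / 2 → (B.card : ℝ) ≤ (C.card : ℝ) / 2 →
      c₃ * ((A ∪ B ∪ C).card : ℝ) / Real.log ((A ∪ B ∪ C).card : ℝ) ≤ (B.card : ℝ) →
      ∀ O : Op n q,
        (condCov H β (A ∪ B ∪ C) (condExp H β (A ∪ B) O) (condExp H β (B ∪ C) O)).re
          ≤ kmsNormSq H β O * (c₁ * Real.exp (-((B.card : ℝ) ^ c₂)))

end SpinChain

end

/-!
The generator is reversible for the KMS inner product, and its Dirichlet form is
`∑ ‖[A, X]‖²` over the single-site Pauli strings `A` on the region (`kmsInner_neg_generator`). Thus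
it is additive over sites, and the gap can be bounded by comparing variances with energies.

*Bounded regions.* The twirl over the Pauli strings of a site is the normalised partial trace, so
twirling over all sites of `R` gives an operator supported outside of `R`, and the variance is at
most its squared distance to `X`. This distance is a sum of terms `[A, X] A†` conjugated by further Pauli
strings, so everything hinges on the multiplication by a single-site operator `A` being bounded in
the KMS norm, that is, on a bound for `‖ρ^{1/4} A ρ^{-1/4}‖` independent of the length of the chain.
Such a bound holds in one dimension at all temperatures (`norm_exp_conj_le`): in a `k`-fold
commutator of `A` with the Hamiltonian, the support grows only by the at most two bonds at its ends,
which turns the number of ways to reach the distance `j` into a convergent series with a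
factor `1 / j!`. The result is `condVar_le_card_mul`.

*Large intervals.* Strong clustering says that the projections of the regions `AB` and `BC` are
nearly orthogonal modulo that of `ABC`, whence
`(1 - 2ε) Var_ABC ≤ Var_AB + Var_BC` (`condVar_union_le`). By additivity, the energies of `AB` and
`BC` add up to the energy of `ABC` plus that of the overlap `B`. In an interval of length `L` there
are about `log L` disjoint positions for an overlap of length about `L / log L`, and averaging over
them replaces the energy of `B` by that of `ABC` times a quantity of order `1 / log L`
(`condVar_interval_le_of_scale`). Hence passing from length `3L/4` to length `L` costs a factor
`1 - K / log L`, and the product of these factors over all scales is a negative power of `log L`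
(`rpow_neg_le_mul_rpow_neg`, `exists_condVar_interval_le`).
-/

namespace SpinChain

open scoped Matrix.Norms.L2Operator ComplexOrder

variable {n q : ℕ}

/-! ### Local operators and the single-site Pauli twirl -/

theorem embedOp_apply (S : Finset (Fin n)) (M : Matrix (S → Site q) (S → Site q) ℂ)
    (σ τ : Config n q) :
    embedOp S M σ τ = if ∀ i, i ∉ S → σ i = τ i then M (fun i => σ i) (fun i => τ i) else 0 :=
  rfl

/-- The entries of the product of two operators with disjoint supports: the intermediate label is
forced to be `τ` on `S` and `σ` elsewhere. -/
theorem embedOp_mul_embedOp_apply {S T : Finset (Fin n)} (h : Disjoint S T)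
    (M : Matrix (S → Site q) (S → Site q) ℂ) (N : Matrix (T → Site q) (T → Site q) ℂ)
    (σ τ : Config n q) :
    (embedOp S M * embedOp T N) σ τ =
      if ∀ i, i ∉ S → i ∉ T → σ i = τ i then
        M (fun i => σ i) (fun i => τ i) * N (fun i => σ i) (fun i => τ i) else 0 := by
  have hST : ∀ i, i ∈ T → i ∉ S := fun i hT hS => Finset.disjoint_left.mp h hS hT
  rw [Matrix.mul_apply, Finset.sum_eq_single (S.piecewise τ σ)]
  · have h1 : ∀ i, i ∉ S → σ i = S.piecewise τ σ i := fun i hi => by simp [hi]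
    have h2 : (fun i : S => S.piecewise τ σ i) = fun i : S => τ i := by
      funext i; simp
    have h3 : (fun i : T => S.piecewise τ σ i) = fun i : T => σ i := by
      funext i; simp [hST i i.2]
    rw [embedOp_apply, embedOp_apply, if_pos h1, h2, h3]
    have h4 : (∀ i, i ∉ T → S.piecewise τ σ i = τ i) ↔ ∀ i, i ∉ S → i ∉ T → σ i = τ i := by
      refine forall_congr' fun i => ?_
      by_cases hi : i ∈ S <;> simp [hi]
    simp only [h4, mul_ite, mul_zero]
  · intro υ _ hυ
    rw [embedOp_apply, embedOp_apply]
    by_contra hne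
    rcases mul_ne_zero_iff.mp hne with ⟨ha, hb⟩
    have ha' := of_not_not fun hn => ha (if_neg hn)
    have hb' := of_not_not fun hn => hb (if_neg hn)
    apply hυ
    funext i
    by_cases hi : i ∈ S
    · rw [Finset.piecewise_eq_of_mem _ _ _ hi]
      exact hb' i fun hT => hST i hT hi
    · rw [Finset.piecewise_eq_of_notMem _ _ _ hi]
      exact (ha' i hi).symm
  · simp

theorem commute_of_mem_localOps {S T : Finset (Fin n)} (h : Disjoint S T) {A B : Op n q}
    (hA : A ∈ localOps S) (hB : B ∈ localOps T) : Commute A B := by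
  obtain ⟨M, rfl⟩ := hA
  obtain ⟨N, rfl⟩ := hB
  ext σ τ
  rw [embedOp_mul_embedOp_apply h, embedOp_mul_embedOp_apply h.symm]
  have : (∀ i, i ∉ S → i ∉ T → σ i = τ i) ↔ ∀ i, i ∉ T → i ∉ S → σ i = τ i :=
    forall_congr' fun i => ⟨fun H a b => H b a, fun H a b => H b a⟩
  simp only [this, mul_comm]

theorem mem_localOps_univ (X : Op n q) : X ∈ localOps (Finset.univ : Finset (Fin n)) := by
  refine ⟨Matrix.of fun σ τ => X (fun i => σ ⟨i, Finset.mem_univ i⟩)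
    (fun i => τ ⟨i, Finset.mem_univ i⟩), ?_⟩
  ext σ τ
  simp [embedOp_apply]

theorem localOps_mono {S T : Finset (Fin n)} (h : S ⊆ T) :
    (localOps S : Submodule ℂ (Op n q)) ≤ localOps T := by
  rintro _ ⟨M, rfl⟩
  refine ⟨Matrix.of fun σ τ => if ∀ i : T, (i : Fin n) ∉ S → σ i = τ i then
    M (fun i => σ ⟨i, h i.2⟩) (fun i => τ ⟨i, h i.2⟩) else 0, ?_⟩
  ext σ τ
  rw [embedOp_apply, embedOp_apply, Matrix.of_apply, ← ite_and]
  congr 1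
  refine propext ⟨fun H i hi => ?_, fun H => ⟨fun i hi => H i fun hS => hi (h hS),
    fun i hi => H i hi⟩⟩
  by_cases hT : i ∈ T
  · exact H.2 ⟨i, hT⟩ hi
  · exact H.1 i hT

/-- The matrix entries of a Pauli string acting on one site. -/
noncomputable def pauliString (s : Fin q → Fin 4) (a b : Site q) : ℂ :=
  ∏ k, pauli (s k) (a k) (b k)

theorem sitePauli_apply (i : Fin n) (s : Fin q → Fin 4) (σ τ : Config n q) :
    sitePauli i s σ τ = if ∀ j, j ≠ i → σ j = τ j then pauliString s (σ i) (τ i) else 0 :=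
  rfl

theorem sitePauli_mem_localOps (i : Fin n) (s : Fin q → Fin 4) :
    sitePauli i s ∈ localOps ({i} : Finset (Fin n)) := by
  refine ⟨Matrix.of fun a b => pauliString s (a ⟨i, Finset.mem_singleton_self i⟩)
    (b ⟨i, Finset.mem_singleton_self i⟩), ?_⟩
  ext σ τ
  simp [embedOp_apply, sitePauli_apply]

/-- Completeness of the Pauli matrices: their entries are orthogonal in the index `p`. -/
theorem sum_pauli_mul_star (a b u v : Fin 2) :
    ∑ p, pauli p a u * star (pauli p b v) = if a = b ∧ u = v then 2 else 0 := by
  fin_cases a <;> fin_cases b <;> fin_cases u <;> fin_cases v <;>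
    simp [pauli, Fin.sum_univ_four] <;> norm_num

theorem pauli_mul_star (p : Fin 4) (a b : Fin 2) :
    ∑ u, pauli p a u * star (pauli p b u) = if a = b then 1 else 0 := by
  fin_cases p <;> fin_cases a <;> fin_cases b <;> simp [pauli]

theorem prod_ite_eq_of_forall {R : Type*} [CommSemiring R] (P : Fin q → Prop) [DecidablePred P]
    (c : R) : (∏ k, if P k then c else 0) = if ∀ k, P k then c ^ q else 0 := by
  split_ifs with h
  · simp [h]
  · push Not at h
    obtain ⟨k, hk⟩ := h
    exact Finset.prod_eq_zero (Finset.mem_univ k) (if_neg hk)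

theorem sum_pauliString_mul_star (a b u v : Site q) :
    ∑ s, pauliString s a u * star (pauliString s b v) = if a = b ∧ u = v then 2 ^ q else 0 := by
  have h : ∀ s : Fin q → Fin 4, pauliString s a u * star (pauliString s b v)
      = ∏ k, pauli (s k) (a k) (u k) * star (pauli (s k) (b k) (v k)) := fun s => by
    rw [pauliString, pauliString, star_prod, Finset.prod_mul_distrib]
  have hp := Finset.prod_univ_sum (fun _ : Fin q => (Finset.univ : Finset (Fin 4)))
    fun k p => pauli p (a k) (u k) * star (pauli p (b k) (v k))
  rw [Fintype.piFinset_univ] at hp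
  simp only [h]
  rw [← hp]
  simp only [sum_pauli_mul_star]
  rw [prod_ite_eq_of_forall]
  congr 1
  rw [funext_iff, funext_iff, forall_and]

theorem pauliString_mul_star (s : Fin q → Fin 4) (a b : Site q) :
    ∑ u, pauliString s a u * star (pauliString s b u) = if a = b then 1 else 0 := by
  have h : ∀ u : Site q, pauliString s a u * star (pauliString s b u)
      = ∏ k, pauli (s k) (a k) (u k) * star (pauli (s k) (b k) (u k)) := fun u => by
    rw [pauliString, pauliString, star_prod, Finset.prod_mul_distrib]
  have hp := Finset.prod_univ_sum (fun _ : Fin q => (Finset.univ : Finset (Fin 2)))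
    fun k u => pauli (s k) (a k) u * star (pauli (s k) (b k) u)
  rw [Fintype.piFinset_univ] at hp
  simp only [h]
  rw [← hp]
  simp only [pauli_mul_star]
  rw [prod_ite_eq_of_forall, one_pow]
  congr 1
  rw [funext_iff]

theorem sitePauli_mul_apply (i : Fin n) (s : Fin q → Fin 4) (X : Op n q) (σ τ : Config n q) :
    (sitePauli i s * X) σ τ = ∑ u, pauliString s (σ i) u * X (Function.update σ i u) τ := by
  rw [Matrix.mul_apply]
  symm
  apply Fintype.sum_of_injective (Function.update σ i) (Function.update_injective σ i)
  · intro υ hυ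
    rw [sitePauli_apply, if_neg, zero_mul]
    intro h
    apply hυ
    refine ⟨υ i, ?_⟩
    funext j
    by_cases hj : j = i
    · subst hj; simp
    · rw [Function.update_of_ne hj, h j hj]
  · intro u
    rw [sitePauli_apply, if_pos fun j hj => by rw [Function.update_of_ne hj], Function.update_self]

theorem mul_conjTranspose_sitePauli_apply (i : Fin n) (s : Fin q → Fin 4) (X : Op n q)
    (σ τ : Config n q) :
    (X * (sitePauli i s).conjTranspose) σ τ
      = ∑ v, X σ (Function.update τ i v) * star (pauliString s (τ i) v) := by
  have h := sitePauli_mul_apply i s X.conjTranspose τ σ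
  have h2 : (X * (sitePauli i s).conjTranspose) σ τ
      = star ((sitePauli i s * X.conjTranspose) τ σ) := by
    rw [← Matrix.conjTranspose_apply, Matrix.conjTranspose_mul, Matrix.conjTranspose_conjTranspose]
  rw [h2, h, star_sum]
  refine Finset.sum_congr rfl fun v _ => ?_
  rw [star_mul, Matrix.conjTranspose_apply, star_star]

theorem sitePauli_mul_conjTranspose (i : Fin n) (s : Fin q → Fin 4) :
    sitePauli i s * (sitePauli i s).conjTranspose = (1 : Op n q) := by
  ext σ τ
  rw [mul_conjTranspose_sitePauli_apply]
  simp only [sitePauli_apply, Function.update_self, ite_mul, zero_mul]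
  have h : ∀ v, (∀ j, j ≠ i → σ j = Function.update τ i v j) ↔ ∀ j, j ≠ i → σ j = τ j := by
    intro v
    refine forall_congr' fun j => imp_congr_right fun hj => ?_
    rw [Function.update_of_ne hj]
  simp only [h]
  rw [Matrix.one_apply]
  by_cases hst : ∀ j, j ≠ i → σ j = τ j
  · simp only [if_pos hst]
    rw [pauliString_mul_star]
    congr 1
    refine propext ⟨fun H => funext fun j => ?_, fun H => by rw [H]⟩
    by_cases hj : j = i
    · rw [hj, H]
    · exact hst j hj
  · have hne : σ ≠ τ := fun H => hst fun j _ => by rw [H]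
    simp [hst, hne]

theorem conjTranspose_mul_sitePauli (i : Fin n) (s : Fin q → Fin 4) :
    (sitePauli i s).conjTranspose * sitePauli i s = (1 : Op n q) :=
  mul_eq_one_comm.mp (sitePauli_mul_conjTranspose i s)

theorem norm_sitePauli (i : Fin n) (s : Fin q → Fin 4) : ‖(sitePauli i s : Op n q)‖ = 1 := by
  have h := Matrix.l2_opNorm_conjTranspose_mul_self (sitePauli i s : Op n q)
  rw [conjTranspose_mul_sitePauli, CStarRing.norm_one] at h
  nlinarith [norm_nonneg (sitePauli i s : Op n q)]

/-- The normalised partial trace over the site `i`, tensored with the identity on this site. -/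
noncomputable def siteTwirl (i : Fin n) (X : Op n q) : Op n q :=
  Matrix.of fun σ τ => if σ i = τ i then
    (2 ^ q : ℂ)⁻¹ * ∑ u, X (Function.update σ i u) (Function.update τ i u) else 0

/-- The twirl over all Pauli strings of a site is the normalised partial trace, by completeness of
the Pauli matrices. -/
theorem siteTwirl_eq_sum (i : Fin n) (X : Op n q) :
    siteTwirl i X = (4 ^ q : ℂ)⁻¹ •
      ∑ s : Fin q → Fin 4, sitePauli i s * X * (sitePauli i s).conjTranspose := by
  ext σ τ
  rw [Matrix.smul_apply, Matrix.sum_apply]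
  have h : ∀ s : Fin q → Fin 4, (sitePauli i s * X * (sitePauli i s).conjTranspose) σ τ
      = ∑ v, ∑ u, X (Function.update σ i u) (Function.update τ i v) *
        (pauliString s (σ i) u * star (pauliString s (τ i) v)) := fun s => by
    rw [mul_conjTranspose_sitePauli_apply]
    refine Finset.sum_congr rfl fun v _ => ?_
    rw [sitePauli_mul_apply, Finset.sum_mul]
    exact Finset.sum_congr rfl fun u _ => by ring
  simp only [h]
  rw [Finset.sum_comm]
  have h2 : ∀ v : Site q, ∑ s : Fin q → Fin 4, ∑ u,
      X (Function.update σ i u) (Function.update τ i v) *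
        (pauliString s (σ i) u * star (pauliString s (τ i) v))
      = if σ i = τ i then X (Function.update σ i v) (Function.update τ i v) * 2 ^ q else 0 := by
    intro v
    rw [Finset.sum_comm]
    simp only [← Finset.mul_sum, sum_pauliString_mul_star]
    by_cases hst : σ i = τ i <;> simp [hst]
  simp only [h2]
  rw [siteTwirl, Matrix.of_apply]
  split_ifs with hst
  · rw [← Finset.sum_mul, smul_eq_mul]
    have h4 : (4 ^ q : ℂ) = 2 ^ q * 2 ^ q := by
      rw [← mul_pow]; norm_num
    rw [h4]
    field_simp
  · simp

/-- Twirling a site `i` removes it from the support. -/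
theorem siteTwirl_mem_localOps (i : Fin n) {S : Finset (Fin n)} {X : Op n q}
    (hX : X ∈ localOps S) : siteTwirl i X ∈ localOps (S.erase i) := by
  obtain ⟨M, rfl⟩ := hX
  let glue (a : {j // j ∈ S.erase i} → Site q) (u : Site q) : S → Site q := fun j =>
    if h : (j : Fin n) = i then u else a ⟨j, Finset.mem_erase.mpr ⟨h, j.2⟩⟩
  refine ⟨Matrix.of fun a b => (2 ^ q : ℂ)⁻¹ * ∑ u, M (glue a u) (glue b u), ?_⟩
  ext σ τ
  rw [embedOp_apply, siteTwirl, Matrix.of_apply]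
  have hglue : ∀ (ρ : Config n q) (u : Site q),
      glue (fun j => ρ j) u = fun j : S => Function.update ρ i u j := by
    intro ρ u
    funext j
    by_cases hj : (j : Fin n) = i
    · simp [glue, hj]
    · simp [glue, hj]
  simp only [embedOp_apply, Matrix.of_apply, hglue]
  have hc : ∀ u : Site q, (∀ j, j ∉ S → Function.update σ i u j = Function.update τ i u j) ↔
      ∀ j, j ∉ S → j ≠ i → σ j = τ j := by
    intro u
    refine forall_congr' fun j => imp_congr_right fun _ => ?_
    by_cases hj : j = i
    · subst hj; simp
    · simp [hj]
  simp only [hc]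
  have he : (∀ j, j ∉ S.erase i → σ j = τ j) ↔
      σ i = τ i ∧ ∀ j, j ∉ S → j ≠ i → σ j = τ j := by
    constructor
    · intro H
      exact ⟨H i (by simp), fun j hj _ => H j fun hm => hj (Finset.mem_of_mem_erase hm)⟩
    · rintro ⟨h1, h2⟩ j hj
      by_cases hji : j = i
      · rw [hji, h1]
      · exact h2 j (fun hm => hj (Finset.mem_erase.mpr ⟨hji, hm⟩)) hji
  simp only [he]
  by_cases h1 : σ i = τ i <;> by_cases h2 : ∀ j, j ∉ S → j ≠ i → σ j = τ j
  · rw [if_pos h1, if_pos ⟨h1, h2⟩]; simp only [if_pos h2]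
  · rw [if_pos h1, if_neg fun H => h2 H.2]; simp only [if_neg h2]; simp
  · rw [if_neg h1, if_neg fun H => h1 H.1]
  · rw [if_neg h1, if_neg fun H => h1 H.1]

/-! ### Imaginary-time evolution of local operators -/

theorem exp_mulLeft_apply {𝔸 : Type*} [NormedRing 𝔸] [NormedAlgebra ℂ 𝔸] [CompleteSpace 𝔸]
    (x a : 𝔸) :
    NormedSpace.exp (ContinuousLinearMap.mul ℂ 𝔸 x) a = NormedSpace.exp x * a := by
  have h1 := (ContinuousLinearMap.apply ℂ 𝔸 a).hasSum
    (NormedSpace.exp_series_hasSum_exp' (𝕂 := ℂ) (ContinuousLinearMap.mul ℂ 𝔸 x))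
  have h2 := ((ContinuousLinearMap.mul ℂ 𝔸).flip a).hasSum
    (NormedSpace.exp_series_hasSum_exp' (𝕂 := ℂ) x)
  have hk : ∀ k : ℕ, ((ContinuousLinearMap.mul ℂ 𝔸 x) ^ k) a = x ^ k * a := by
    intro k
    induction k with
    | zero => simp
    | succ k ih => rw [pow_succ', pow_succ', mul_apply_eq_comp, ih]; simp [mul_assoc]
  simp only [ContinuousLinearMap.apply_apply, smul_apply, hk] at h1
  simp only [ContinuousLinearMap.flip_apply, ContinuousLinearMap.mul_apply', smul_mul_assoc] at h2
  exact h1.unique h2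

theorem exp_mulRight_apply {𝔸 : Type*} [NormedRing 𝔸] [NormedAlgebra ℂ 𝔸] [CompleteSpace 𝔸]
    (x a : 𝔸) :
    NormedSpace.exp ((ContinuousLinearMap.mul ℂ 𝔸).flip x) a = a * NormedSpace.exp x := by
  have h1 := (ContinuousLinearMap.apply ℂ 𝔸 a).hasSum
    (NormedSpace.exp_series_hasSum_exp' (𝕂 := ℂ) ((ContinuousLinearMap.mul ℂ 𝔸).flip x))
  have h2 := (ContinuousLinearMap.mul ℂ 𝔸 a).hasSum
    (NormedSpace.exp_series_hasSum_exp' (𝕂 := ℂ) x)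
  have hk : ∀ k : ℕ, (((ContinuousLinearMap.mul ℂ 𝔸).flip x) ^ k) a = a * x ^ k := by
    intro k
    induction k with
    | zero => simp
    | succ k ih => rw [pow_succ', pow_succ, mul_apply_eq_comp, ih]; simp [mul_assoc]
  simp only [ContinuousLinearMap.apply_apply, smul_apply, hk] at h1
  simp only [ContinuousLinearMap.mul_apply', mul_smul_comm] at h2
  exact h1.unique h2

/-- The expansion `e^x a e^{-x} = ∑ₖ ad_x^k(a) / k!`. -/
theorem hasSum_exp_conj {𝔸 : Type*} [NormedRing 𝔸] [NormedAlgebra ℂ 𝔸] [CompleteSpace 𝔸]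
    (x a : 𝔸) :
    HasSum (fun k : ℕ => ((k.factorial : ℂ)⁻¹) • (fun y => x * y - y * x)^[k] a)
      (NormedSpace.exp x * a * NormedSpace.exp (-x)) := by
  set L := ContinuousLinearMap.mul ℂ 𝔸 x with hL
  set R := (ContinuousLinearMap.mul ℂ 𝔸).flip (-x) with hR
  have hc : Commute L R := by
    refine ContinuousLinearMap.ext fun y => ?_
    simp [hL, hR, mul_assoc]
  have h1 := (ContinuousLinearMap.apply ℂ 𝔸 a).hasSum
    (NormedSpace.exp_series_hasSum_exp' (𝕂 := ℂ) (R + L))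
  let _ : NormedAlgebra ℚ (𝔸 →L[ℂ] 𝔸) := NormedAlgebra.restrictScalars ℚ ℂ _
  have he : NormedSpace.exp (R + L) a = NormedSpace.exp x * a * NormedSpace.exp (-x) := by
    rw [NormedSpace.exp_add_of_commute hc.symm, mul_apply_eq_comp,
      exp_mulLeft_apply, exp_mulRight_apply]
  have hk : ∀ k : ℕ, ((R + L) ^ k) a = (fun y => x * y - y * x)^[k] a := by
    intro k
    induction k with
    | zero => simp
    | succ k ih =>
      rw [pow_succ', mul_apply_eq_comp, ih, Function.iterate_succ_apply']
      simp [hL, hR, sub_eq_neg_add]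
  simp only [ContinuousLinearMap.apply_apply, smul_apply, hk, he] at h1
  exact h1

/-- The operators that commute with everything acting outside of `S`. -/
noncomputable def supportAlg (q : ℕ) (S : Finset (Fin n)) : Subalgebra ℂ (Op n q) :=
  Subalgebra.centralizer ℂ ((localOps Sᶜ : Submodule ℂ (Op n q)) : Set (Op n q))

theorem commute_of_mem_supportAlg {S T : Finset (Fin n)} (h : Disjoint S T) {X B : Op n q}
    (hX : X ∈ supportAlg q S) (hB : B ∈ localOps T) : B * X = X * B :=
  hX B (localOps_mono (Finset.subset_compl_iff_disjoint_left.mpr h) hB)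

theorem mem_supportAlg_of_mem_localOps {S T : Finset (Fin n)} (h : S ⊆ T) {X : Op n q}
    (hX : X ∈ localOps S) : X ∈ supportAlg q T := fun _ hB =>
  (commute_of_mem_localOps
    (Finset.disjoint_of_subset_left h disjoint_compl_right) hX hB).symm.eq

theorem supportAlg_mono {S T : Finset (Fin n)} (h : S ⊆ T) :
    supportAlg q S ≤ supportAlg q T :=
  Subalgebra.centralizer_le ℂ _ _ (localOps_mono (Finset.compl_subset_compl.mpr h))

/-- The sites at distance at most `j` from the site `i`. -/
def siteBall (i : Fin n) (j : ℕ) : Finset (Fin n) :=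
  {x | (i : ℕ) ≤ x + j ∧ (x : ℕ) ≤ i + j}

/-- The bonds inside of `siteBall i j`. -/
def innerBonds (i : Fin n) (j : ℕ) : Finset (Fin (n - 1)) :=
  {b | (i : ℕ) ≤ b + j ∧ (b : ℕ) + 1 ≤ i + j}

/-- The bonds between `siteBall i j` and its complement. On a side where the ball reaches the end
of the chain there is none. -/
def outerBonds (i : Fin n) (j : ℕ) : Finset (Fin (n - 1)) :=
  {b | (b : ℕ) + j + 1 = i ∨ (b : ℕ) = i + j}

theorem card_innerBonds_le (i : Fin n) (j : ℕ) : (innerBonds i j).card ≤ 2 * j := by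
  have h : (innerBonds i j).card ≤ (Finset.Ico ((i : ℕ) - j) (i + j)).card := by
    refine Finset.card_le_card_of_injOn (fun b => (b : ℕ)) ?_ (Fin.val_injective.injOn)
    intro b hb
    simp only [innerBonds, Finset.coe_filter, Set.mem_ofPred_eq, Finset.mem_univ, true_and] at hb
    simp only [Finset.coe_Ico, Set.mem_Ico]
    omega
  rw [Nat.card_Ico] at h
  omega

theorem card_outerBonds_le (i : Fin n) (j : ℕ) : (outerBonds i j).card ≤ 2 := by
  have h : (outerBonds i j).card ≤ ({(i : ℕ) - j - 1, (i : ℕ) + j} : Finset ℕ).card := by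
    refine Finset.card_le_card_of_injOn (fun b => (b : ℕ)) ?_ (Fin.val_injective.injOn)
    intro b hb
    simp only [outerBonds, Finset.coe_filter, Set.mem_ofPred_eq, Finset.mem_univ, true_and] at hb
    simp only [Finset.coe_insert, Finset.coe_singleton, Set.mem_insert_iff, Set.mem_singleton_iff]
    omega
  exact h.trans Finset.card_le_two

/-- The commutator of an operator supported on a ball with `H` splits into a part supported on the
same ball, from the bonds inside, and a part supported on the next ball, from the at most two
bonds at the boundary. -/
theorem commutator_total_split (H : Hamiltonian1D n q) (i : Fin n) (j : ℕ) {X : Op n q}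
    (hX : X ∈ supportAlg q (siteBall i j)) :
    ∃ Y Z : Op n q, H.total * X - X * H.total = Y + Z ∧
      Y ∈ supportAlg q (siteBall i j) ∧ Z ∈ supportAlg q (siteBall i (j + 1)) ∧
      ‖Y‖ ≤ 4 * j * ‖X‖ ∧ ‖Z‖ ≤ 4 * ‖X‖ := by
  let com : Op n q →ₗ[ℂ] Op n q := LinearMap.mulRight ℂ X - LinearMap.mulLeft ℂ X
  have hcom : ∀ h : Op n q, com h = h * X - X * h := fun h => by simp [com]
  have hnorm : ∀ s : Finset (Fin (n - 1)), ‖∑ b ∈ s, com (H.term b)‖ ≤ s.card * (2 * ‖X‖) := by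
    intro s
    refine (norm_sum_le _ _).trans ?_
    rw [← nsmul_eq_mul]
    refine Finset.sum_le_card_nsmul _ _ _ fun b _ => ?_
    rw [hcom]
    have h1 := norm_mul_le (H.term b) X
    have h2 := norm_mul_le X (H.term b)
    have h3 := norm_sub_le (H.term b * X) (X * H.term b)
    have h4 := H.norm_le b
    nlinarith [norm_nonneg X, norm_nonneg (H.term b)]
  have hmem : ∀ (T : Finset (Fin n)) (s : Finset (Fin (n - 1))), siteBall i j ⊆ T →
      (∀ b ∈ s, ({⟨b, by omega⟩, ⟨b + 1, by omega⟩} : Finset (Fin n)) ⊆ T) →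
      ∑ b ∈ s, com (H.term b) ∈ supportAlg q T := by
    intro T s hT hs
    refine sum_mem fun b hb => ?_
    have h1 := mem_supportAlg_of_mem_localOps (hs b hb) (H.supported b)
    have h2 := supportAlg_mono hT hX
    rw [hcom]
    exact sub_mem (mul_mem h1 h2) (mul_mem h2 h1)
  refine ⟨∑ b ∈ innerBonds i j, com (H.term b), ∑ b ∈ outerBonds i j, com (H.term b), ?_,
    ?_, ?_, ?_, ?_⟩
  · have hd : Disjoint (innerBonds i j) (outerBonds i j) := by
      rw [Finset.disjoint_left]
      intro b hb hb'
      simp only [innerBonds, outerBonds, Finset.mem_filter, Finset.mem_univ, true_and] at hb hb'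
      omega
    rw [← Finset.sum_union hd, ← hcom, Hamiltonian1D.total, map_sum]
    symm
    refine Finset.sum_subset (Finset.subset_univ _) fun b _ hb => ?_
    rw [hcom, sub_eq_zero]
    refine commute_of_mem_supportAlg ?_ hX (H.supported b)
    rw [Finset.disjoint_right]
    intro x hx
    simp only [innerBonds, outerBonds, siteBall, Finset.mem_union, Finset.mem_filter,
      Finset.mem_univ, true_and, Finset.mem_insert, Finset.mem_singleton] at hb hx ⊢
    rcases hx with rfl | rfl <;> simp only <;> omega
  · refine hmem _ _ subset_rfl fun b hb x hx => ?_
    simp only [innerBonds, siteBall, Finset.mem_filter,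
      Finset.mem_univ, true_and, Finset.mem_insert, Finset.mem_singleton] at hb hx ⊢
    rcases hx with rfl | rfl <;> simp only <;> omega
  · refine hmem _ _ (fun x hx => ?_) fun b hb x hx => ?_
    · simp only [siteBall, Finset.mem_filter, Finset.mem_univ, true_and] at hx ⊢
      omega
    · simp only [outerBonds, siteBall, Finset.mem_filter,
        Finset.mem_univ, true_and, Finset.mem_insert, Finset.mem_singleton] at hb hx ⊢
      rcases hx with rfl | rfl <;> simp only <;> omega
  · refine (hnorm _).trans ?_
    have : ((innerBonds i j).card : ℝ) ≤ 2 * j := by exact_mod_cast card_innerBonds_le i j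
    nlinarith [norm_nonneg X]
  · refine (hnorm _).trans ?_
    have : ((outerBonds i j).card : ℝ) ≤ 2 := by exact_mod_cast card_outerBonds_le i j
    nlinarith [norm_nonneg X]

/-- The weight of the operators supported on the ball of radius `j` in a `k`-fold commutator: of
the `k` steps `j` enlarge the ball, each in at most two ways, and the other ones use
one of at most `2 * j` bonds. -/
noncomputable def commutatorWeight (k j : ℕ) : ℝ := 4 ^ j * k.choose j * (4 * j) ^ (k - j)

theorem commutatorWeight_nonneg (k j : ℕ) : 0 ≤ commutatorWeight k j := by
  unfold commutatorWeight; positivity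

theorem commutatorWeight_step_zero (k : ℕ) :
    4 * ((0 : ℕ) : ℝ) * commutatorWeight k 0 ≤ commutatorWeight (k + 1) 0 := by
  simpa using commutatorWeight_nonneg (k + 1) 0

theorem commutatorWeight_step (k j : ℕ) :
    4 * ((j + 1 : ℕ) : ℝ) * commutatorWeight k (j + 1) + 4 * commutatorWeight k j
      ≤ commutatorWeight (k + 1) (j + 1) := by
  unfold commutatorWeight
  rw [Nat.choose_succ_succ, Nat.add_sub_add_right]
  have h1 : 4 * ((j + 1 : ℕ) : ℝ) * (4 ^ (j + 1) * (k.choose (j + 1)) *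
      (4 * ((j + 1 : ℕ) : ℝ)) ^ (k - (j + 1)))
      = 4 ^ (j + 1) * (k.choose (j + 1)) * (4 * ((j + 1 : ℕ) : ℝ)) ^ (k - j) := by
    rcases Nat.lt_or_ge k (j + 1) with h | h
    · simp [Nat.choose_eq_zero_of_lt h]
    · have : k - j = k - (j + 1) + 1 := by omega
      rw [this, pow_succ]
      ring
  have h2 : ((4 : ℝ) * j) ^ (k - j) ≤ (4 * ((j + 1 : ℕ) : ℝ)) ^ (k - j) := by
    gcongr
    simp
  rw [h1]
  have h3 : (4 : ℝ) * (4 ^ j * (k.choose j) * (4 * j) ^ (k - j))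
      ≤ 4 ^ (j + 1) * (k.choose j) * (4 * ((j + 1 : ℕ) : ℝ)) ^ (k - j) := by
    rw [pow_succ]
    nlinarith [mul_le_mul_of_nonneg_left h2 (show (0 : ℝ) ≤ 4 * 4 ^ j * k.choose j by positivity)]
  push_cast at h3 ⊢
  linarith

/-- An iterated commutator with `H`, sorted by the radius of the ball around `i` that carries it. -/
theorem iterate_commutator_decomp (H : Hamiltonian1D n q) (i : Fin n) {A : Op n q}
    (hA : A ∈ localOps ({i} : Finset (Fin n))) (k : ℕ) :
    ∃ X : ℕ → Op n q, (∀ j, X j ∈ supportAlg q (siteBall i j)) ∧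
      (∀ j, ‖X j‖ ≤ commutatorWeight k j * ‖A‖) ∧
      (fun Y => H.total * Y - Y * H.total)^[k] A = ∑ j ∈ Finset.range (k + 1), X j := by
  induction k with
  | zero =>
    refine ⟨fun j => if j = 0 then A else 0, fun j => ?_, fun j => ?_, by simp⟩
    · by_cases hj : j = 0
      · subst hj
        simp only [if_true]
        refine mem_supportAlg_of_mem_localOps ?_ hA
        simp [siteBall]
      · simp [hj, zero_mem]
    · by_cases hj : j = 0
      · subst hj
        simp [commutatorWeight]
      · simp only [hj, if_false, norm_zero]
        exact mul_nonneg (commutatorWeight_nonneg _ _) (norm_nonneg _)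
  | succ k ih =>
    obtain ⟨X, hXs, hXn, hXe⟩ := ih
    choose Y Z hYZ hY hZ hYn hZn using fun j => commutator_total_split H i j (hXs j)
    have hX0 : X (k + 1) = 0 := by
      have := hXn (k + 1)
      simpa [commutatorWeight] using this
    have hY0 : Y (k + 1) = 0 := by
      have := hYn (k + 1)
      simpa [hX0] using this
    refine ⟨fun j => Nat.casesOn j (Y 0) fun j => Y (j + 1) + Z j, ?_, ?_, ?_⟩
    · rintro (_ | j)
      · exact hY 0
      · exact add_mem (hY (j + 1)) (hZ j)
    · rintro (_ | j)
      · refine (hYn 0).trans ?_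
        have := mul_le_mul_of_nonneg_right (commutatorWeight_step_zero k) (norm_nonneg A)
        simpa using this
      · refine (norm_add_le _ _).trans ?_
        have h1 := hYn (j + 1)
        have h2 := hZn j
        have h3 := mul_le_mul_of_nonneg_left (hXn (j + 1))
          (show (0 : ℝ) ≤ 4 * ((j + 1 : ℕ) : ℝ) by positivity)
        have h4 := hXn j
        have h5 := mul_le_mul_of_nonneg_right (commutatorWeight_step k j) (norm_nonneg A)
        linarith
    · rw [Function.iterate_succ_apply', hXe, Finset.mul_sum, Finset.sum_mul,
        ← Finset.sum_sub_distrib, Finset.sum_congr rfl fun j _ => hYZ j,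
        Finset.sum_add_distrib, Finset.sum_range_succ' _ (k + 1)]
      change _ = ∑ j ∈ Finset.range (k + 1), (Y (j + 1) + Z j) + Y 0
      rw [Finset.sum_add_distrib, Finset.sum_range_succ (fun j => Y (j + 1)) k, hY0,
        Finset.sum_range_succ' Y k]
      abel

/-- Substituting `k = j + m` turns the sum into `∑ (4t)^j / j! * ∑ (4jt)^m / m!`, whose inner sums
are exponentials. -/
theorem sum_commutatorWeight_le {t : ℝ} (ht : 0 ≤ t) (K : ℕ) :
    ∑ k ∈ Finset.range K, t ^ k / k.factorial * ∑ j ∈ Finset.range (k + 1), commutatorWeight k j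
      ≤ Real.exp (4 * t * Real.exp (4 * t)) := by
  calc ∑ k ∈ Finset.range K, t ^ k / k.factorial *
        ∑ j ∈ Finset.range (k + 1), commutatorWeight k j
      = ∑ k ∈ Finset.range K, ∑ j ∈ Finset.range (k + 1),
          (4 * t) ^ j / j.factorial * ((4 * j * t) ^ (k - j) / (k - j).factorial) := by
        refine Finset.sum_congr rfl fun k _ => ?_
        rw [Finset.mul_sum]
        refine Finset.sum_congr rfl fun j hj => ?_
        have hjk : j ≤ k := Nat.lt_succ_iff.mp (Finset.mem_range.mp hj)
        obtain ⟨m, rfl⟩ := Nat.exists_eq_add_of_le hjk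
        unfold commutatorWeight
        rw [Nat.add_sub_cancel_left, Nat.cast_add_choose, mul_pow 4 t, mul_pow _ t m, pow_add]
        field_simp
    _ ≤ ∑ j ∈ Finset.range K, ∑ m ∈ Finset.range K,
          (4 * t) ^ j / j.factorial * ((4 * j * t) ^ m / m.factorial) := by
        rw [Finset.sum_sigma', ← Finset.sum_product']
        have hinj : Set.InjOn (fun p : Σ _ : ℕ, ℕ => ((p.2, p.1 - p.2) : ℕ × ℕ))
            ((Finset.range K).sigma fun k => Finset.range (k + 1) : Finset (Σ _ : ℕ, ℕ)) := by
          rintro ⟨k, j⟩ h ⟨k', j'⟩ h' he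
          simp only [Finset.coe_sigma, Set.mem_sigma_iff, Finset.coe_range, Set.mem_Iio] at h h'
          simp only [Prod.mk.injEq] at he
          obtain ⟨rfl, he⟩ := he
          have : k = k' := by omega
          rw [this]
        have hs := Finset.sum_image (s := (Finset.range K).sigma fun k => Finset.range (k + 1))
          (f := fun p : ℕ × ℕ => (4 * t) ^ p.1 / p.1.factorial *
            ((4 * p.1 * t) ^ p.2 / p.2.factorial)) hinj
        rw [← hs]
        refine Finset.sum_le_sum_of_subset_of_nonneg ?_ fun p _ _ => by positivity
        intro p hp
        simp only [Finset.mem_image, Finset.mem_sigma, Finset.mem_range] at hp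
        obtain ⟨⟨k, j⟩, ⟨h1, h2⟩, rfl⟩ := hp
        simp only [Finset.mem_product, Finset.mem_range] at h1 h2 ⊢
        omega
    _ ≤ ∑ j ∈ Finset.range K, (4 * t * Real.exp (4 * t)) ^ j / j.factorial := by
        refine Finset.sum_le_sum fun j _ => ?_
        rw [← Finset.mul_sum, mul_pow _ (Real.exp _), ← Real.exp_nat_mul, mul_div_right_comm]
        refine mul_le_mul_of_nonneg_left ?_ (by positivity)
        have := Real.sum_le_exp_of_nonneg (show 0 ≤ 4 * j * t by positivity) K
        rwa [show 4 * (j : ℝ) * t = j * (4 * t) by ring] at *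
    _ ≤ _ := Real.sum_le_exp_of_nonneg (by positivity) K

/-- In one dimension the evolution in imaginary time of a single-site operator is bounded uniformly
in the length of the chain and in the Hamiltonian. To reach the sites at distance `j` the bonds at
the distances `1, …, j` have to appear in this order in the iterated commutators, which leads to
a factor `1 / j!` and makes the expansion converge at all times. -/
theorem norm_exp_conj_le (H : Hamiltonian1D n q) (i : Fin n) {A : Op n q}
    (hA : A ∈ localOps ({i} : Finset (Fin n))) (t : ℝ) :
    ‖NormedSpace.exp ((t : ℂ) • H.total) * A * NormedSpace.exp (-((t : ℂ) • H.total))‖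
      ≤ Real.exp (4 * |t| * Real.exp (4 * |t|)) * ‖A‖ := by
  have hs := hasSum_exp_conj ((t : ℂ) • H.total) A
  have hit : ∀ k : ℕ, (fun y => (t : ℂ) • H.total * y - y * (t : ℂ) • H.total)^[k] A
      = (t : ℂ) ^ k • (fun Y => H.total * Y - Y * H.total)^[k] A := by
    intro k
    induction k with
    | zero => simp
    | succ k ih =>
      rw [Function.iterate_succ_apply', ih, Function.iterate_succ_apply', pow_succ']
      simp only [Matrix.smul_mul, Matrix.mul_smul, smul_smul, smul_sub, mul_comm]
  simp only [hit] at hs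
  refine le_of_tendsto hs.tendsto_sum_nat.norm (Filter.Eventually.of_forall fun K => ?_)
  refine (norm_sum_le _ _).trans ?_
  have hk : ∀ k : ℕ, ‖((k.factorial : ℂ)⁻¹) • (t : ℂ) ^ k •
      (fun Y => H.total * Y - Y * H.total)^[k] A‖
      ≤ |t| ^ k / k.factorial * (∑ j ∈ Finset.range (k + 1), commutatorWeight k j) * ‖A‖ := by
    intro k
    obtain ⟨X, -, hXn, hXe⟩ := iterate_commutator_decomp H i hA k
    rw [hXe, norm_smul, norm_smul, norm_inv, norm_pow, Complex.norm_real, Complex.norm_natCast,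
      Real.norm_eq_abs, mul_assoc, Finset.sum_mul, ← mul_assoc, inv_mul_eq_div]
    exact mul_le_mul_of_nonneg_left
      ((norm_sum_le _ _).trans (Finset.sum_le_sum fun j _ => hXn j)) (by positivity)
  refine (Finset.sum_le_sum fun k _ => hk k).trans ?_
  rw [← Finset.sum_mul]
  exact mul_le_mul_of_nonneg_right (sum_commutatorWeight_le (abs_nonneg t) K) (norm_nonneg A)

/-! ### The KMS norm and multiplication by single-site operators -/

theorem trace_conjTranspose_mul_self_re {ι : Type*} [Fintype ι] [DecidableEq ι] (W : Matrix ι ι ℂ) :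
    (W.conjTranspose * W).trace.re = ∑ j, ‖WithLp.toLp 2 (W.col j)‖ ^ 2 := by
  rw [Matrix.trace, Complex.re_sum]
  refine Finset.sum_congr rfl fun j _ => ?_
  rw [EuclideanSpace.norm_sq_eq, Matrix.diag_apply, Matrix.mul_apply, Complex.re_sum]
  refine Finset.sum_congr rfl fun i _ => ?_
  rw [Matrix.conjTranspose_apply]
  change ((starRingEnd ℂ) (W i j) * W i j).re = ‖W i j‖ ^ 2
  rw [← Complex.normSq_eq_conj_mul_self, Complex.ofReal_re, Complex.normSq_eq_norm_sq]

theorem trace_conjTranspose_mul_self_mul_left_le {ι : Type*} [Fintype ι] [DecidableEq ι]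
    (U W : Matrix ι ι ℂ) :
    ((U * W).conjTranspose * (U * W)).trace.re
      ≤ ‖U‖ ^ 2 * (W.conjTranspose * W).trace.re := by
  rw [trace_conjTranspose_mul_self_re, trace_conjTranspose_mul_self_re, Finset.mul_sum]
  refine Finset.sum_le_sum fun j _ => ?_
  rw [← mul_pow]
  refine pow_le_pow_left₀ (norm_nonneg _) ?_ 2
  exact Matrix.l2_opNorm_mulVec U (WithLp.toLp 2 (W.col j))

theorem trace_conjTranspose_mul_self_mul_right_le {ι : Type*} [Fintype ι] [DecidableEq ι]
    (U W : Matrix ι ι ℂ) :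
    ((W * U).conjTranspose * (W * U)).trace.re
      ≤ ‖U‖ ^ 2 * (W.conjTranspose * W).trace.re := by
  have h := trace_conjTranspose_mul_self_mul_left_le U.conjTranspose W.conjTranspose
  rw [← Matrix.conjTranspose_mul, Matrix.conjTranspose_conjTranspose, Matrix.trace_mul_comm,
    Matrix.conjTranspose_conjTranspose, Matrix.trace_mul_comm W,
    Matrix.l2_opNorm_conjTranspose] at h
  exact h

theorem kmsNormSq_eq_norm_sq (H : Hamiltonian1D n q) (β : ℝ) (X : Op n q) :
    kmsNormSq H β X = ‖toKMS H β X‖ ^ 2 := by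
  rw [← inner_self_eq_norm_sq (𝕜 := ℂ), inner_toKMS]
  rfl

theorem kmsNormSq_eq_trace (H : Hamiltonian1D n q) (β : ℝ) (X : Op n q) :
    kmsNormSq H β X = ((gibbsPow H β (1 / 4) * X * gibbsPow H β (1 / 4)).conjTranspose
      * (gibbsPow H β (1 / 4) * X * gibbsPow H β (1 / 4))).trace.re := by
  rw [kmsNormSq, kmsInner_eq]

theorem gibbsPow_mul_gibbsPow_neg (H : Hamiltonian1D n q) (β s : ℝ) :
    gibbsPow H β s * gibbsPow H β (-s) = 1 := by
  rw [← gibbsPow_add, add_neg_cancel]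
  simp [gibbsPow]

theorem gibbsPow_neg_mul_gibbsPow (H : Hamiltonian1D n q) (β s : ℝ) :
    gibbsPow H β (-s) * gibbsPow H β s = 1 :=
  mul_eq_one_comm.mp (gibbsPow_mul_gibbsPow_neg H β s)

/-- Conjugation by a power of the Gibbs state is evolution in imaginary time. -/
theorem gibbsPow_conj (H : Hamiltonian1D n q) (β s : ℝ) (A : Op n q) :
    gibbsPow H β s * A * gibbsPow H β (-s)
      = NormedSpace.exp (((-(s * β) : ℝ) : ℂ) • H.total) * A *
        NormedSpace.exp (-(((-(s * β) : ℝ) : ℂ) • H.total)) := by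
  have hz : (((partitionFn H β) ^ (-s) : ℝ) : ℂ) * (((partitionFn H β) ^ (-(-s)) : ℝ) : ℂ) = 1 := by
    rw [← Complex.ofReal_mul, ← Real.rpow_add (gibbs_trace_pos H β).1, add_neg_cancel,
      Real.rpow_zero, Complex.ofReal_one]
  have he : -(((-(s * β) : ℝ) : ℂ) • H.total) = (-((-s : ℝ) * β) : ℂ) • H.total := by
    rw [← neg_smul]
    push_cast
    ring_nf
  rw [he]
  unfold gibbsPow
  rw [Matrix.smul_mul, Matrix.smul_mul, Matrix.mul_smul, smul_smul, hz, one_smul]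
  push_cast
  rfl

/-- A bound, depending only on the temperature, for the multiplication by a single-site operator of
norm at most one in the KMS norm. -/
noncomputable def kmsMulBound (β : ℝ) : ℝ := Real.exp (β * Real.exp β)

theorem one_le_kmsMulBound {β : ℝ} (hβ : 0 ≤ β) : 1 ≤ kmsMulBound β :=
  Real.one_le_exp (by positivity)

theorem norm_gibbsPow_conj_le (H : Hamiltonian1D n q) {β : ℝ} (hβ : 0 ≤ β) (i : Fin n) {A : Op n q}
    (hA : A ∈ localOps ({i} : Finset (Fin n))) (hA1 : ‖A‖ ≤ 1) {s : ℝ} (hs : |s| = 1 / 4) :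
    ‖gibbsPow H β s * A * gibbsPow H β (-s)‖ ≤ kmsMulBound β := by
  rw [gibbsPow_conj]
  refine (norm_exp_conj_le H i hA _).trans ?_
  have ht : 4 * |(-(s * β))| = β := by
    rw [abs_neg, abs_mul, hs, abs_of_nonneg hβ]
    ring
  rw [ht, kmsMulBound]
  exact mul_le_of_le_one_right (Real.exp_pos _).le hA1

theorem norm_toKMS_mul_left_le (H : Hamiltonian1D n q) {β : ℝ} (hβ : 0 ≤ β) (i : Fin n) {A : Op n q}
    (hA : A ∈ localOps ({i} : Finset (Fin n))) (hA1 : ‖A‖ ≤ 1) (X : Op n q) :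
    ‖toKMS H β (A * X)‖ ≤ kmsMulBound β * ‖toKMS H β X‖ := by
  have hM : 0 ≤ kmsMulBound β := (Real.exp_pos _).le
  refine (pow_le_pow_iff_left₀ (norm_nonneg _) (by positivity) two_ne_zero).mp ?_
  rw [mul_pow, ← kmsNormSq_eq_norm_sq, ← kmsNormSq_eq_norm_sq, kmsNormSq_eq_trace,
    kmsNormSq_eq_trace]
  set g := gibbsPow H β (1 / 4) with hg
  have he : g * (A * X) * g = (g * A * gibbsPow H β (-(1 / 4))) * (g * X * g) := by
    have := gibbsPow_neg_mul_gibbsPow H β (1 / 4)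
    calc g * (A * X) * g = g * A * 1 * X * g := by simp only [mul_assoc, mul_one]
      _ = _ := by rw [← this]; simp only [mul_assoc, hg]
  rw [he]
  refine (trace_conjTranspose_mul_self_mul_left_le _ _).trans ?_
  refine mul_le_mul_of_nonneg_right ?_ ?_
  · exact pow_le_pow_left₀ (norm_nonneg _)
      (norm_gibbsPow_conj_le H hβ i hA hA1 (by norm_num)) 2
  · rw [trace_conjTranspose_mul_self_re]
    positivity

theorem norm_toKMS_mul_right_le (H : Hamiltonian1D n q) {β : ℝ} (hβ : 0 ≤ β) (i : Fin n)
    {A : Op n q} (hA : A ∈ localOps ({i} : Finset (Fin n))) (hA1 : ‖A‖ ≤ 1) (X : Op n q) :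
    ‖toKMS H β (X * A)‖ ≤ kmsMulBound β * ‖toKMS H β X‖ := by
  have hM : 0 ≤ kmsMulBound β := (Real.exp_pos _).le
  refine (pow_le_pow_iff_left₀ (norm_nonneg _) (by positivity) two_ne_zero).mp ?_
  rw [mul_pow, ← kmsNormSq_eq_norm_sq, ← kmsNormSq_eq_norm_sq, kmsNormSq_eq_trace,
    kmsNormSq_eq_trace]
  set g := gibbsPow H β (1 / 4) with hg
  have he : g * (X * A) * g
      = (g * X * g) * (gibbsPow H β (-(1 / 4)) * A * gibbsPow H β (-(-(1 / 4)))) := by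
    have := gibbsPow_mul_gibbsPow_neg H β (1 / 4)
    calc g * (X * A) * g = g * X * 1 * A * g := by simp only [mul_assoc, mul_one]
      _ = _ := by rw [← this, neg_neg]; simp only [mul_assoc, hg]
  rw [he]
  refine (trace_conjTranspose_mul_self_mul_right_le _ _).trans ?_
  refine mul_le_mul_of_nonneg_right ?_ ?_
  · exact pow_le_pow_left₀ (norm_nonneg _)
      (norm_gibbsPow_conj_le H hβ i hA hA1 (by norm_num)) 2
  · rw [trace_conjTranspose_mul_self_re]
    positivity

/-! ### The Dirichlet form -/

/-- The contribution of the site `i` to the Dirichlet form, `∑ ‖[A, X]‖²` over the Pauli strings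
`A` on this site. -/
noncomputable def siteEnergy (H : Hamiltonian1D n q) (β : ℝ) (X : Op n q) (i : Fin n) : ℝ :=
  ∑ s : Fin q → Fin 4, kmsNormSq H β (sitePauli i s * X - X * sitePauli i s)

theorem siteEnergy_nonneg (H : Hamiltonian1D n q) (β : ℝ) (X : Op n q) (i : Fin n) :
    0 ≤ siteEnergy H β X i :=
  Finset.sum_nonneg fun s _ => by rw [kmsNormSq_eq_norm_sq]; positivity

/-- Integration by parts: the form of one jump operator is a squared commutator. -/
theorem kmsInner_jumpGenerator (H : Hamiltonian1D n q) (β : ℝ) (A X : Op n q) :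
    kmsInner H β X (jumpGenerator H β A X)
      = -kmsInner H β (A * X - X * A) (A * X - X * A) := by
  have h1 := gibbsPow_mul_gibbsPow_neg H β (1 / 2)
  have h2 := gibbsPow_neg_mul_gibbsPow H β (1 / 2)
  unfold kmsInner jumpGenerator
  set r := gibbsPow H β (1 / 2)
  set r' := gibbsPow H β (-(1 / 2))
  set D := A * X - X * A with hD
  have e1 : X.conjTranspose * r *
        (D * (r * A.conjTranspose * r') - r' * A.conjTranspose * r * D) * r
      = X.conjTranspose * r * D * r * A.conjTranspose
        - X.conjTranspose * A.conjTranspose * r * D * r := by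
    calc _ = X.conjTranspose * r * D * r * A.conjTranspose * (r' * r)
          - X.conjTranspose * (r * r') * A.conjTranspose * r * D * r := by
          simp only [mul_sub, sub_mul, mul_assoc]
      _ = _ := by rw [h1, h2, mul_one, mul_one]
  have e2 : D.conjTranspose
      = X.conjTranspose * A.conjTranspose - A.conjTranspose * X.conjTranspose := by
    rw [hD, Matrix.conjTranspose_sub, Matrix.conjTranspose_mul, Matrix.conjTranspose_mul]
  rw [e1, e2, Matrix.trace_sub, Matrix.trace_mul_comm _ A.conjTranspose, ← Matrix.trace_neg,
    ← Matrix.trace_sub]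
  congr 1
  simp only [sub_mul, mul_assoc, neg_sub]

theorem kmsInner_neg_generator (H : Hamiltonian1D n q) (β : ℝ) (R : Finset (Fin n)) (X : Op n q) :
    (kmsInner H β X (-generator H β R X)).re = ∑ i ∈ R, siteEnergy H β X i := by
  rw [← inner_toKMS, map_neg, inner_neg_right, generator, map_sum, inner_sum,
    ← Finset.sum_neg_distrib, Complex.re_sum]
  refine Finset.sum_congr rfl fun i _ => ?_
  rw [map_sum, inner_sum, ← Finset.sum_neg_distrib, Complex.re_sum]
  refine Finset.sum_congr rfl fun s _ => ?_
  rw [inner_toKMS, kmsInner_jumpGenerator, neg_neg]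
  rfl

/-! ### A spectral gap for regions of bounded size -/

theorem siteTwirl_sub (i : Fin n) (X Y : Op n q) :
    siteTwirl i (X - Y) = siteTwirl i X - siteTwirl i Y := by
  simp only [siteTwirl_eq_sum, mul_sub, sub_mul, Finset.sum_sub_distrib, smul_sub]

theorem sitePauli_conjTranspose_mem (i : Fin n) (s : Fin q → Fin 4) :
    (sitePauli i s : Op n q).conjTranspose ∈ localOps ({i} : Finset (Fin n)) := by
  obtain ⟨M, hM⟩ := sitePauli_mem_localOps (n := n) i s
  refine ⟨M.conjTranspose, ?_⟩
  ext σ τ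
  rw [← hM, Matrix.conjTranspose_apply, embedOp_apply, embedOp_apply]
  have : (∀ j, j ∉ ({i} : Finset (Fin n)) → σ j = τ j) ↔
      ∀ j, j ∉ ({i} : Finset (Fin n)) → τ j = σ j :=
    forall_congr' fun j => imp_congr_right fun _ => eq_comm
  simp only [this, apply_ite star, star_zero, Matrix.conjTranspose_apply]

theorem norm_sitePauli_conjTranspose (i : Fin n) (s : Fin q → Fin 4) :
    ‖(sitePauli i s : Op n q).conjTranspose‖ = 1 := by
  rw [Matrix.l2_opNorm_conjTranspose, norm_sitePauli]

theorem card_pauliStrings : Fintype.card (Fin q → Fin 4) = 4 ^ q := by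
  simp

theorem norm_toKMS_siteTwirl_le (H : Hamiltonian1D n q) {β : ℝ} (hβ : 0 ≤ β) (i : Fin n)
    (X : Op n q) : ‖toKMS H β (siteTwirl i X)‖ ≤ kmsMulBound β ^ 2 * ‖toKMS H β X‖ := by
  have h4 : ‖(4 ^ q : ℂ)⁻¹‖ = (4 ^ q : ℝ)⁻¹ := by simp
  rw [siteTwirl_eq_sum, map_smul, norm_smul, map_sum, h4]
  have h : ‖∑ s : Fin q → Fin 4, toKMS H β (sitePauli i s * X * (sitePauli i s).conjTranspose)‖
      ≤ 4 ^ q * (kmsMulBound β ^ 2 * ‖toKMS H β X‖) := by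
    refine (norm_sum_le _ _).trans ?_
    refine (Finset.sum_le_card_nsmul _ _ (kmsMulBound β ^ 2 * ‖toKMS H β X‖)
      fun s _ => ?_).trans ?_
    · refine (norm_toKMS_mul_right_le H hβ i (sitePauli_conjTranspose_mem i s)
        (norm_sitePauli_conjTranspose i s).le _).trans ?_
      rw [sq, mul_assoc]
      exact mul_le_mul_of_nonneg_left (norm_toKMS_mul_left_le H hβ i (sitePauli_mem_localOps i s)
        (norm_sitePauli i s).le X) (Real.exp_pos _).le
    · rw [Finset.card_univ, card_pauliStrings, nsmul_eq_mul]
      push_cast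
      rfl
  rw [inv_mul_le_iff₀ (by positivity)]
  exact h

theorem norm_toKMS_sub_siteTwirl_le (H : Hamiltonian1D n q) {β : ℝ} (hβ : 0 ≤ β) (i : Fin n)
    (X : Op n q) :
    ‖toKMS H β (X - siteTwirl i X)‖ ≤ kmsMulBound β * √(siteEnergy H β X i) := by
  have hM : 0 ≤ kmsMulBound β := (Real.exp_pos _).le
  have h4 : ‖(4 ^ q : ℂ)⁻¹‖ = (4 ^ q : ℝ)⁻¹ := by simp
  have he : X - siteTwirl i X = -((4 ^ q : ℂ)⁻¹ • ∑ s : Fin q → Fin 4,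
      (sitePauli i s * X - X * sitePauli i s) * (sitePauli i s).conjTranspose) := by
    have hs : ∀ s : Fin q → Fin 4,
        (sitePauli i s * X - X * sitePauli i s) * (sitePauli i s).conjTranspose
        = sitePauli i s * X * (sitePauli i s).conjTranspose - X := fun s => by
      rw [sub_mul, mul_assoc X, sitePauli_mul_conjTranspose, mul_one]
    simp only [hs, Finset.sum_sub_distrib, smul_sub, ← siteTwirl_eq_sum]
    rw [Finset.sum_const, Finset.card_univ, card_pauliStrings, ← Nat.cast_smul_eq_nsmul ℂ,
      smul_smul]
    push_cast
    rw [inv_mul_cancel₀ (by positivity), one_smul, neg_sub]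
  have h1 : ∑ s : Fin q → Fin 4, ‖toKMS H β (sitePauli i s * X - X * sitePauli i s)‖
      ≤ 4 ^ q * √(siteEnergy H β X i) := by
    refine (pow_le_pow_iff_left₀ (by positivity) (by positivity) two_ne_zero).mp ?_
    refine (sq_sum_le_card_mul_sum_sq (s := Finset.univ)).trans ?_
    rw [mul_pow, Real.sq_sqrt (siteEnergy_nonneg H β X i), Finset.card_univ, card_pauliStrings]
    have hE : ∑ s : Fin q → Fin 4, ‖toKMS H β (sitePauli i s * X - X * sitePauli i s)‖ ^ 2
        = siteEnergy H β X i :=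
      Finset.sum_congr rfl fun s _ => (kmsNormSq_eq_norm_sq H β _).symm
    rw [hE]
    refine mul_le_mul_of_nonneg_right ?_ (siteEnergy_nonneg H β X i)
    push_cast
    exact le_self_pow₀ (one_le_pow₀ (by norm_num)) two_ne_zero
  rw [he, map_neg, norm_neg, map_smul, norm_smul, map_sum, h4, inv_mul_le_iff₀ (by positivity)]
  calc _ ≤ ∑ s : Fin q → Fin 4,
        kmsMulBound β * ‖toKMS H β (sitePauli i s * X - X * sitePauli i s)‖ :=
        (norm_sum_le _ _).trans (Finset.sum_le_sum fun s _ =>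
          norm_toKMS_mul_right_le H hβ i (sitePauli_conjTranspose_mem i s)
            (norm_sitePauli_conjTranspose i s).le _)
    _ ≤ _ := by
      rw [← Finset.mul_sum]
      nlinarith [mul_le_mul_of_nonneg_left h1 hM]

/-- Twirling the sites of `R` one by one moves `X` by an amount controlled by their energies, up to
a factor `kmsMulBound β ^ 2` for each further twirl. -/
theorem exists_localOps_compl_near (H : Hamiltonian1D n q) {β : ℝ} (hβ : 0 ≤ β) (X : Op n q)
    (R : Finset (Fin n)) :
    ∃ Y ∈ localOps Rᶜ, ‖toKMS H β (X - Y)‖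
      ≤ kmsMulBound β ^ (2 * R.card) * ∑ i ∈ R, √(siteEnergy H β X i) := by
  have hM := one_le_kmsMulBound hβ
  induction R using Finset.induction_on with
  | empty => exact ⟨X, by simpa using mem_localOps_univ X, by simp⟩
  | insert i R hi ih =>
    obtain ⟨Y, hY, hXY⟩ := ih
    refine ⟨siteTwirl i Y, ?_, ?_⟩
    · rw [Finset.compl_insert]
      exact siteTwirl_mem_localOps i hY
    · have he : X - siteTwirl i Y = (X - siteTwirl i X) + siteTwirl i (X - Y) := by
        rw [siteTwirl_sub]; abel
      rw [he, map_add, Finset.sum_insert hi, Finset.card_insert_of_notMem hi]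
      refine (norm_add_le _ _).trans ?_
      have h1 := norm_toKMS_sub_siteTwirl_le H hβ i X
      have h2 := (norm_toKMS_siteTwirl_le H hβ i (X - Y)).trans
        (mul_le_mul_of_nonneg_left hXY (by positivity))
      have h3 : kmsMulBound β ≤ kmsMulBound β ^ (2 * (R.card + 1)) :=
        le_self_pow₀ hM (by omega)
      have h4 := mul_le_mul_of_nonneg_right h3 (Real.sqrt_nonneg (siteEnergy H β X i))
      have h5 : kmsMulBound β ^ (2 * (R.card + 1))
          = kmsMulBound β ^ 2 * kmsMulBound β ^ (2 * R.card) := by ring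
      rw [mul_add]
      rw [← mul_assoc, ← h5] at h2
      linarith

/-- The subspace of the KMS Hilbert space formed by the operators supported outside of `R`. -/
noncomputable def kmsLocal (H : Hamiltonian1D n q) (β : ℝ) (R : Finset (Fin n)) :
    Submodule ℂ (KMSSpace H β) :=
  (localOps Rᶜ).map (toKMS H β).toLinearMap

theorem toKMS_condExp (H : Hamiltonian1D n q) (β : ℝ) (R : Finset (Fin n)) (X : Op n q) :
    toKMS H β (condExp H β R X) = (kmsLocal H β R).starProjection (toKMS H β X) :=
  rfl

theorem condVar_eq_norm_sq (H : Hamiltonian1D n q) (β : ℝ) (R : Finset (Fin n)) (X : Op n q) :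
    condVar H β R X
      = ‖toKMS H β X - (kmsLocal H β R).starProjection (toKMS H β X)‖ ^ 2 := by
  rw [condVar, kmsNormSq_eq_norm_sq, map_sub, toKMS_condExp]

theorem condVar_nonneg (H : Hamiltonian1D n q) (β : ℝ) (R : Finset (Fin n)) (X : Op n q) :
    0 ≤ condVar H β R X := by
  rw [condVar_eq_norm_sq]; positivity

theorem condVar_le_of_mem (H : Hamiltonian1D n q) (β : ℝ) {R : Finset (Fin n)} (X : Op n q)
    {Y : Op n q} (hY : Y ∈ localOps Rᶜ) :
    condVar H β R X ≤ ‖toKMS H β (X - Y)‖ ^ 2 := by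
  have hmem : toKMS H β Y ∈ kmsLocal H β R := Submodule.mem_map_of_mem hY
  rw [condVar_eq_norm_sq, map_sub]
  refine pow_le_pow_left₀ (norm_nonneg _) ?_ 2
  rw [Submodule.starProjection_minimal]
  exact ciInf_le ⟨0, by rintro _ ⟨y, rfl⟩; positivity⟩ (⟨_, hmem⟩ : kmsLocal H β R)

/-- The gap of a region is bounded below in terms of its size alone, uniformly in the chain and the
Hamiltonian: the twirl over all sites of the region is a competitor for the projection. -/
theorem condVar_le_card_mul (H : Hamiltonian1D n q) {β : ℝ} (hβ : 0 ≤ β) (X : Op n q)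
    (R : Finset (Fin n)) :
    condVar H β R X
      ≤ R.card * kmsMulBound β ^ (4 * R.card) * ∑ i ∈ R, siteEnergy H β X i := by
  obtain ⟨Y, hY, hXY⟩ := exists_localOps_compl_near H hβ X R
  refine (condVar_le_of_mem H β X hY).trans ((pow_le_pow_left₀ (norm_nonneg _) hXY 2).trans ?_)
  have h := sq_sum_le_card_mul_sum_sq (s := R) (f := fun i => √(siteEnergy H β X i))
  simp only [Real.sq_sqrt (siteEnergy_nonneg H β X _)] at h
  rw [mul_pow, ← pow_mul, show 2 * R.card * 2 = 4 * R.card by ring]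
  have hM : 0 ≤ kmsMulBound β ^ (4 * R.card) := pow_nonneg (Real.exp_pos _).le _
  nlinarith [mul_le_mul_of_nonneg_left h hM]

/-! ### Quasi-factorization of the conditional variance -/

/-- If two orthogonal projections are nearly orthogonal on `f`, then `f` is nearly controlled by the
two complementary projections: expand `0 ≤ ‖f - P f - Q f‖²`. -/
theorem norm_sq_le_of_re_inner_starProjection_le {E : Type*} [NormedAddCommGroup E]
    [InnerProductSpace ℂ E] (U V : Submodule ℂ E) [U.HasOrthogonalProjection]
    [V.HasOrthogonalProjection] (f : E) {ε : ℝ}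
    (h : (inner ℂ (U.starProjection f) (V.starProjection f)).re ≤ ‖f‖ ^ 2 * ε) :
    (1 - 2 * ε) * ‖f‖ ^ 2
      ≤ ‖f - U.starProjection f‖ ^ 2 + ‖f - V.starProjection f‖ ^ 2 := by
  have hproj : ∀ (W : Submodule ℂ E) [W.HasOrthogonalProjection],
      (inner ℂ f (W.starProjection f)).re = ‖W.starProjection f‖ ^ 2 := by
    intro W _
    have h1 := W.starProjection_inner_eq_zero f _ (W.starProjection_apply_mem f)
    rw [inner_sub_left, sub_eq_zero] at h1
    rw [h1]
    exact inner_self_eq_norm_sq (𝕜 := ℂ) _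
  have hU := hproj U
  have hV := hproj V
  set a := U.starProjection f
  set c := V.starProjection f
  have h1 := norm_sub_sq (𝕜 := ℂ) f a
  have h2 := norm_sub_sq (𝕜 := ℂ) f c
  have h3 := norm_sub_sq (𝕜 := ℂ) (f - a) c
  rw [inner_sub_left] at h3
  simp only [RCLike.re_to_complex, Complex.sub_re] at h1 h2 h3
  nlinarith [sq_nonneg ‖f - a - c‖]

theorem kmsLocal_anti (H : Hamiltonian1D n q) (β : ℝ) {R S : Finset (Fin n)} (h : R ⊆ S) :
    kmsLocal H β S ≤ kmsLocal H β R :=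
  Submodule.map_mono (localOps_mono (Finset.compl_subset_compl.mpr h))

/-- Quasi-factorization of the variance under a clustering bound. The bound is applied to the part
of `O` orthogonal to the operators supported outside of `A ∪ B ∪ C`, so that its right-hand side is
a variance. -/
theorem condVar_union_le (H : Hamiltonian1D n q) (β : ℝ) (A B C : Finset (Fin n)) {ε : ℝ}
    (h : ∀ O : Op n q, (condCov H β (A ∪ B ∪ C) (condExp H β (A ∪ B) O)
      (condExp H β (B ∪ C) O)).re ≤ kmsNormSq H β O * ε) (O : Op n q) :
    (1 - 2 * ε) * condVar H β (A ∪ B ∪ C) O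
      ≤ condVar H β (A ∪ B) O + condVar H β (B ∪ C) O := by
  have hAB : kmsLocal H β (A ∪ B ∪ C) ≤ kmsLocal H β (A ∪ B) :=
    kmsLocal_anti H β Finset.subset_union_left
  have hBC : kmsLocal H β (A ∪ B ∪ C) ≤ kmsLocal H β (B ∪ C) :=
    kmsLocal_anti H β (by rw [Finset.union_assoc]; exact Finset.subset_union_right)
  have h1 := h (O - condExp H β (A ∪ B ∪ C) O)
  rw [condCov, ← inner_toKMS, kmsNormSq_eq_norm_sq] at h1
  simp only [map_sub, toKMS_condExp] at h1
  rw [condVar_eq_norm_sq, condVar_eq_norm_sq, condVar_eq_norm_sq]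
  set K := kmsLocal H β (A ∪ B ∪ C)
  set U := kmsLocal H β (A ∪ B)
  set V := kmsLocal H β (B ∪ C)
  set o := toKMS H β O
  have hK : K.starProjection o ∈ K := K.starProjection_apply_mem o
  have hU0 : U.starProjection (K.starProjection o) = K.starProjection o :=
    Submodule.starProjection_eq_self_iff.mpr (hAB hK)
  have hV0 : V.starProjection (K.starProjection o) = K.starProjection o :=
    Submodule.starProjection_eq_self_iff.mpr (hBC hK)
  have hKK : K.starProjection (K.starProjection o) = K.starProjection o :=
    Submodule.starProjection_eq_self_iff.mpr hK
  have hKU : ∀ x, K.starProjection (U.starProjection x) = K.starProjection x := fun x =>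
    congrArg (fun g => g x) (Submodule.starProjection_comp_starProjection_of_le hAB)
  have hKV : ∀ x, K.starProjection (V.starProjection x) = K.starProjection x := fun x =>
    congrArg (fun g => g x) (Submodule.starProjection_comp_starProjection_of_le hBC)
  have h2 := norm_sq_le_of_re_inner_starProjection_le U V (o - K.starProjection o) (ε := ε) (by
    simp only [map_sub]
    simpa only [hKU, hKV, hKK, sub_self, sub_zero] using h1)
  simp only [map_sub, hU0, hV0, sub_sub_sub_cancel_right] at h2
  exact h2

/-! ### Averaging over the position of the overlap -/

theorem mem_interval {a b : ℕ} {i : Fin n} : i ∈ interval n a b ↔ a ≤ (i : ℕ) ∧ (i : ℕ) < b := by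
  simp [interval]

theorem card_interval {a b : ℕ} (hb : b ≤ n) : (interval n a b).card = b - a := by
  have h : (interval n a b).map Fin.valEmbedding = Finset.Ico a b := by
    ext x
    simp only [Finset.mem_map, mem_interval, Fin.valEmbedding_apply, Finset.mem_Ico]
    constructor
    · rintro ⟨i, hi, rfl⟩
      exact hi
    · intro hx
      exact ⟨⟨x, by omega⟩, hx, rfl⟩
  rw [← Finset.card_map Fin.valEmbedding, h, Nat.card_Ico]

theorem interval_union {a b c : ℕ} (hab : a ≤ b) (hbc : b ≤ c) :
    interval n a b ∪ interval n b c = interval n a c := by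
  ext i
  simp only [Finset.mem_union, mem_interval]
  omega

/-- For any of `s` disjoint intervals `B` of length `b` in the middle of an interval `R` of length
`L`, quasi-factorization bounds the variance in `R` by the energy in `R` plus that in `B`. As the
latter ones add up to at most the energy in `R`, averaging over `B` only costs a factor
`1 + 1 / s`. -/
theorem condVar_interval_le_of_scale (H : Hamiltonian1D n q) {β c₁ c₂ c₃ : ℝ}
    (hSC : StrongClustering H β c₁ c₂ c₃) {a L b s : ℕ} (haL : a + L ≤ n) (hb : 1 ≤ b)
    (hbL : 6 * b ≤ L) (hsL : 4 * (s * b) ≤ L) (hc : c₃ * L / Real.log L ≤ b) {lam : ℝ}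
    (hlam : 0 ≤ lam) (O : Op n q)
    (hgap : ∀ x y : ℕ, x + 2 ≤ y → y ≤ n → 4 * (y - x) ≤ 3 * L →
      lam * condVar H β (interval n x y) O ≤ ∑ i ∈ interval n x y, siteEnergy H β O i) :
    lam * (1 - 2 * (c₁ * Real.exp (-((b : ℝ) ^ c₂)))) * s
        * condVar H β (interval n a (a + L)) O
      ≤ (s + 1) * ∑ i ∈ interval n a (a + L), siteEnergy H β O i := by
  set ε := c₁ * Real.exp (-((b : ℝ) ^ c₂))
  set R := interval n a (a + L)
  let B : ℕ → Finset (Fin n) := fun k =>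
    interval n (a + L / 3 + k * b) (a + L / 3 + (k + 1) * b)
  have hstep : ∀ k ∈ Finset.range s, lam * (1 - 2 * ε) * condVar H β R O
      ≤ ∑ i ∈ R, siteEnergy H β O i + ∑ i ∈ B k, siteEnergy H β O i := by
    intro k hk
    have hks : (k + 1) * b ≤ s * b := Nat.mul_le_mul_right _ (Finset.mem_range.mp hk)
    have hkb : (k + 1) * b = k * b + b := by ring
    set y := a + L / 3 + k * b
    set z := a + L / 3 + (k + 1) * b
    have hAB : interval n a y ∪ interval n y z = interval n a z :=
      interval_union (by omega) (by omega)
    have hBC : interval n y z ∪ interval n z (a + L) = interval n y (a + L) :=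
      interval_union (by omega) (by omega)
    have hABC : interval n a y ∪ interval n y z ∪ interval n z (a + L) = R := by
      rw [hAB, interval_union (by omega) (by omega)]
    have hRc : R.card = L := by rw [card_interval haL]; omega
    have hBc : (interval n y z).card = b := by rw [card_interval (by omega)]; omega
    have hq := condVar_union_le H β (interval n a y) (interval n y z) (interval n z (a + L))
      (ε := ε) (fun O => by
        have := hSC a y z (a + L) (by omega) (by omega) (by omega) haL _ _ _ rfl rfl rfl
          (by
            rw [le_div_iff₀ two_pos]
            have : (interval n y z).card * 2 ≤ (interval n a y).card := by
              rw [hBc, card_interval (by omega)]; omega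
            exact_mod_cast this)
          (by
            rw [le_div_iff₀ two_pos]
            have : (interval n y z).card * 2 ≤ (interval n z (a + L)).card := by
              rw [hBc, card_interval (by omega)]; omega
            exact_mod_cast this)
          (by rw [hABC, hRc, hBc]; exact hc) O
        rwa [hBc] at this) O
    rw [hABC, hAB, hBC] at hq
    have h1 := hgap a z (by omega) (by omega) (by omega)
    have h2 := hgap y (a + L) (by omega) (by omega) (by omega)
    have h3 := mul_le_mul_of_nonneg_left hq hlam
    have hsum := Finset.sum_union_inter (s₁ := interval n a z) (s₂ := interval n y (a + L))
      (f := siteEnergy H β O)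
    have hu : interval n a z ∪ interval n y (a + L) = R := by
      ext i
      simp only [R, Finset.mem_union, mem_interval]
      omega
    have hi : interval n a z ∩ interval n y (a + L) = B k := by
      ext i
      simp only [B, Finset.mem_inter, mem_interval]
      omega
    rw [hu, hi] at hsum
    linarith
  have hB : ∑ k ∈ Finset.range s, ∑ i ∈ B k, siteEnergy H β O i
      ≤ ∑ i ∈ R, siteEnergy H β O i := by
    rw [← Finset.sum_biUnion]
    · refine Finset.sum_le_sum_of_subset_of_nonneg ?_ fun i _ _ => siteEnergy_nonneg H β O i
      intro i hi
      simp only [B, Finset.mem_biUnion, Finset.mem_range, mem_interval] at hi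
      obtain ⟨k, hk, hi⟩ := hi
      have hks : (k + 1) * b ≤ s * b := Nat.mul_le_mul_right _ hk
      simp only [R, mem_interval]
      omega
    · intro k _ l _ hkl
      rw [Function.onFun, Finset.disjoint_left]
      intro i hi hi'
      simp only [B, mem_interval] at hi hi'
      rcases Nat.lt_or_gt_of_ne hkl with h | h
      · have := Nat.mul_le_mul_right b (Nat.succ_le_of_lt h)
        rw [Nat.succ_eq_add_one] at this
        omega
      · have := Nat.mul_le_mul_right b (Nat.succ_le_of_lt h)
        rw [Nat.succ_eq_add_one] at this
        omega
  have h := Finset.sum_le_sum hstep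
  rw [Finset.sum_add_distrib, Finset.sum_const, Finset.sum_const, Finset.card_range,
    nsmul_eq_mul, nsmul_eq_mul] at h
  linarith

/-! ### The choice of scales and the recursion -/

/-- On a large interval of length `L` there is room for `s`, of order `log L`, disjoint
overlaps of length `b`, of order `L / log L`, and the clustering error at this scale is at
most `1 / log L`. -/
theorem exists_scale {c₁ c₂ c₃ : ℝ} (hc₁ : 0 < c₁) (hc₂ : 0 < c₂) (hc₃ : 0 < c₃) (K : ℝ) :
    ∃ L₀ : ℕ, ∀ L : ℕ, L₀ ≤ L → ∃ b s : ℕ, 1 ≤ b ∧ 1 ≤ s ∧ 6 * b ≤ L ∧ 4 * (s * b) ≤ L ∧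
      c₃ * L / Real.log L ≤ b ∧ K ≤ Real.log L ∧
      1 / (s : ℝ) ≤ 8 * (c₃ + 1) / Real.log L ∧
      2 * (c₁ * Real.exp (-((b : ℝ) ^ c₂))) ≤ 1 / Real.log L := by
  have hlog : Filter.Tendsto (fun L : ℕ => Real.log L) Filter.atTop Filter.atTop :=
    Real.tendsto_log_atTop.comp tendsto_natCast_atTop_atTop
  have hlittle : ∀ {r C : ℝ}, 0 < r → 0 < C →
      ∀ᶠ L : ℕ in Filter.atTop, Real.log L ≤ C * (L : ℝ) ^ r := by
    intro r C hr hC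
    have h := tendsto_natCast_atTop_atTop (R := ℝ) |>.eventually
      ((isLittleO_log_rpow_atTop hr).bound hC)
    filter_upwards [h] with L hL
    rw [Real.norm_eq_abs, Real.norm_of_nonneg (by positivity)] at hL
    exact (le_abs_self _).trans hL
  have hev := ((hlog.eventually_ge_atTop (max K (max 1 (max (4 * (c₃ + 1)) (12 * c₃))))).and
    ((hlittle (r := 1 / 2) (by norm_num) hc₃).and ((hlittle (r := c₂ / 2) (by positivity)
      one_pos).and ((hlittle (r := 1) one_pos (C := (2 * c₁)⁻¹) (by positivity)).and
        (Filter.eventually_ge_atTop 12)))))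
  obtain ⟨L₀, hL₀⟩ := Filter.eventually_atTop.mp hev
  refine ⟨L₀, fun L hL => ?_⟩
  obtain ⟨h1, h2, h3, h4, h5⟩ := hL₀ L hL
  simp only [max_le_iff] at h1
  obtain ⟨hK, hx1, hx2, hx3⟩ := h1
  rw [Real.rpow_one] at h4
  rw [one_mul] at h3
  have hL12 : (12 : ℝ) ≤ L := by exact_mod_cast h5
  set x := Real.log L with hx
  have hx0 : 0 < x := by linarith
  have hxL : x ≤ L := (Real.log_le_sub_one_of_pos (by linarith)).trans (by linarith)
  have hpos : 0 < c₃ * L / x := by positivity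
  -- the number of overlaps is `κ * log L` with `κ = 1 / (4 * (c₃ + 1))`
  have hκ : 1 ≤ x / (4 * (c₃ + 1)) := by rw [le_div_iff₀ (by positivity)]; linarith
  have hsfl := Nat.lt_floor_add_one (x / (4 * (c₃ + 1)))
  have hsle := Nat.floor_le (show 0 ≤ x / (4 * (c₃ + 1)) by linarith)
  have hs1 : 1 ≤ ⌊x / (4 * (c₃ + 1))⌋₊ := Nat.le_floor (by simpa using hκ)
  have hble := Nat.le_ceil (c₃ * L / x)
  have hblt := Nat.ceil_lt_add_one hpos.le
  set b := ⌈c₃ * L / x⌉₊ with hb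
  set s := ⌊x / (4 * (c₃ + 1))⌋₊
  have hs1' : (1 : ℝ) ≤ s := by exact_mod_cast hs1
  refine ⟨b, s, Nat.ceil_pos.mpr hpos, hs1, ?_, ?_, hble, hK, ?_, ?_⟩
  · have h6 : c₃ * L / x ≤ L / 12 := by
      rw [div_le_div_iff₀ hx0 (by norm_num)]
      nlinarith
    have : (6 : ℝ) * b ≤ L := by linarith
    exact_mod_cast this
  · have h6 : (s : ℝ) * b ≤ x / (4 * (c₃ + 1)) * (c₃ * L / x + 1) := by
      gcongr
    have h7 : x / (4 * (c₃ + 1)) * (c₃ * L / x + 1) = (c₃ * L + x) / (4 * (c₃ + 1)) := by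
      field_simp
    have h8 : (c₃ * L + x) / (4 * (c₃ + 1)) ≤ L / 4 := by
      rw [div_le_div_iff₀ (by positivity) (by norm_num)]
      nlinarith
    have : (4 : ℝ) * (s * b) ≤ L := by linarith
    exact_mod_cast this
  · have h6 : x / (4 * (c₃ + 1)) ≤ 2 * s := by linarith
    rw [div_le_iff₀ (by positivity)] at h6
    rw [div_le_div_iff₀ (by positivity) hx0]
    linarith
  · -- `b ≥ L ^ (1 / 2)`, hence `b ^ c₂ ≥ log L` and the error is at most `c₁ / L`
    have hLp : (0 : ℝ) < L := by linarith
    have h6 : (L : ℝ) ^ (1 / 2 : ℝ) ≤ c₃ * L / x := by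
      rw [le_div_iff₀ hx0]
      have h7 : (L : ℝ) = (L : ℝ) ^ (1 / 2 : ℝ) * (L : ℝ) ^ (1 / 2 : ℝ) := by
        rw [← Real.rpow_add hLp]; norm_num
      calc (L : ℝ) ^ (1 / 2 : ℝ) * x
          ≤ (L : ℝ) ^ (1 / 2 : ℝ) * (c₃ * (L : ℝ) ^ (1 / 2 : ℝ)) := by gcongr
        _ = c₃ * ((L : ℝ) ^ (1 / 2 : ℝ) * (L : ℝ) ^ (1 / 2 : ℝ)) := by ring
        _ = c₃ * L := by rw [← h7]
    have h8 : x ≤ (b : ℝ) ^ c₂ := by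
      refine h3.trans ?_
      rw [show c₂ / 2 = 1 / 2 * c₂ by ring, Real.rpow_mul hLp.le]
      exact Real.rpow_le_rpow (by positivity) (h6.trans hble) hc₂.le
    have h9 : Real.exp (-((b : ℝ) ^ c₂)) ≤ (L : ℝ)⁻¹ := by
      rw [← Real.exp_log hLp, ← Real.exp_neg]
      exact Real.exp_le_exp.mpr (by linarith)
    have h10 : 2 * (c₁ * Real.exp (-((b : ℝ) ^ c₂))) ≤ 2 * (c₁ * (L : ℝ)⁻¹) := by gcongr
    refine h10.trans ?_
    rw [le_div_iff₀ hx0]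
    have h11 : 2 * (c₁ * (L : ℝ)⁻¹) * ((2 * c₁)⁻¹ * L) = 1 := by
      field_simp
    calc 2 * (c₁ * (L : ℝ)⁻¹) * x ≤ 2 * (c₁ * (L : ℝ)⁻¹) * ((2 * c₁)⁻¹ * L) := by gcongr
      _ = 1 := h11

/-- The losses `1 - K / log L` at the scales `L, (3 / 4) L, …` multiply up to a power of
`log L`. -/
theorem rpow_neg_le_mul_rpow_neg {K d x : ℝ} (hK : 0 < K) (hd : 0 < d) (hx : 2 * K ≤ x)
    (hdx : d < x) :
    x ^ (-(2 * K / d)) ≤ (x - d) ^ (-(2 * K / d)) * (1 - K / x) := by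
  have hx0 : 0 < x := by linarith
  have hxd : 0 < x - d := by linarith
  have hKx : K / x ≤ 1 / 2 := by rw [div_le_div_iff₀ hx0 two_pos]; linarith
  have hKx0 : 0 < K / x := by positivity
  have h1 : Real.log (x - d) ≤ Real.log x - d / x := by
    have h := Real.log_le_sub_one_of_pos (div_pos hxd hx0)
    rw [Real.log_div hxd.ne' hx0.ne', sub_div, div_self hx0.ne'] at h
    linarith
  have h2 : x ^ (-(2 * K / d)) * Real.exp (2 * (K / x)) ≤ (x - d) ^ (-(2 * K / d)) := by
    rw [Real.rpow_def_of_pos hx0, Real.rpow_def_of_pos hxd, ← Real.exp_add]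
    refine Real.exp_le_exp.mpr ?_
    have h3 : 2 * (K / x) = d / x * (2 * K / d) := by field_simp
    rw [h3]
    nlinarith [mul_le_mul_of_nonneg_right h1 (show 0 ≤ 2 * K / d by positivity)]
  have h3 : 1 ≤ Real.exp (2 * (K / x)) * (1 - K / x) := by
    have := Real.add_one_le_exp (2 * (K / x))
    nlinarith
  have h4 : 0 < x ^ (-(2 * K / d)) := Real.rpow_pos_of_pos hx0 _
  calc x ^ (-(2 * K / d)) ≤ x ^ (-(2 * K / d)) * (Real.exp (2 * (K / x)) * (1 - K / x)) :=
        le_mul_of_one_le_right h4.le h3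
    _ = x ^ (-(2 * K / d)) * Real.exp (2 * (K / x)) * (1 - K / x) := by ring
    _ ≤ _ := by
      refine mul_le_mul_of_nonneg_right h2 ?_
      linarith

/-- The gap inequality for all intervals of length at least `2`, by induction on the length:
intervals up to a fixed length are covered by the bound for bounded regions, and a longer one
is reduced to intervals of at most three quarters of its length. -/
theorem exists_condVar_interval_le (q : ℕ) {β c₁ c₂ c₃ : ℝ} (hβ : 0 ≤ β) (hc₁ : 0 < c₁)
    (hc₂ : 0 < c₂) (hc₃ : 0 < c₃) :
    ∃ lam₀ c : ℝ, 0 < lam₀ ∧ 0 < c ∧ ∀ (n : ℕ) (H : Hamiltonian1D n q),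
      StrongClustering H β c₁ c₂ c₃ → ∀ (O : Op n q) (L a : ℕ), 2 ≤ L → a + L ≤ n →
        lam₀ * Real.log L ^ (-c) * condVar H β (interval n a (a + L)) O
          ≤ ∑ i ∈ interval n a (a + L), siteEnergy H β O i := by
  set K := 1 + 8 * (c₃ + 1) with hK
  have hK0 : 0 < K := by positivity
  set d := Real.log (4 / 3) with hd
  have hd0 : 0 < d := Real.log_pos (by norm_num)
  obtain ⟨L₀, hL₀⟩ := exists_scale hc₁ hc₂ hc₃ (2 * K)
  set c := 2 * K / d with hc
  have hc0 : 0 < c := by positivity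
  have hM := one_le_kmsMulBound hβ
  have hM0 : 0 < kmsMulBound β := by linarith
  have hlog2 : 0 < Real.log 2 := Real.log_pos (by norm_num)
  set base : ℝ := (L₀ + 1) * kmsMulBound β ^ (4 * (L₀ + 1)) with hbase
  have hbase0 : 0 < base := by positivity
  set lam₀ := base⁻¹ * Real.log 2 ^ c with hlam₀
  have hlam0 : 0 < lam₀ := by positivity
  refine ⟨lam₀, c, hlam0, hc0, fun n H hSC O L => ?_⟩
  induction L using Nat.strong_induction_on with
  | _ L ih =>
    intro a hL2 haL
    have hL2' : (2 : ℝ) ≤ L := by exact_mod_cast hL2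
    have hV := condVar_nonneg H β (interval n a (a + L)) O
    set E := ∑ i ∈ interval n a (a + L), siteEnergy H β O i
    have hE : 0 ≤ E := Finset.sum_nonneg fun i _ => siteEnergy_nonneg H β O i
    by_cases hLs : L ≤ L₀
    · have h1 := condVar_le_card_mul H hβ O (interval n a (a + L))
      have hcard : (interval n a (a + L)).card = L := by rw [card_interval haL]; omega
      rw [hcard] at h1
      have h2 : (L : ℝ) * kmsMulBound β ^ (4 * L) ≤ base := by
        have : (L : ℝ) ≤ L₀ + 1 := by exact_mod_cast hLs.trans (Nat.le_succ _)
        have hp : kmsMulBound β ^ (4 * L) ≤ kmsMulBound β ^ (4 * (L₀ + 1)) :=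
          pow_le_pow_right₀ hM (by omega)
        rw [hbase]
        gcongr
      have h3 : lam₀ * Real.log L ^ (-c) ≤ base⁻¹ := by
        rw [hlam₀, mul_assoc]
        refine mul_le_of_le_one_right (by positivity) ?_
        have hll : Real.log 2 ≤ Real.log L := Real.log_le_log two_pos hL2'
        rw [Real.rpow_neg (by linarith), ← div_eq_mul_inv,
          div_le_one (Real.rpow_pos_of_pos (by linarith) _)]
        exact Real.rpow_le_rpow hlog2.le hll hc0.le
      calc lam₀ * Real.log L ^ (-c) * condVar H β (interval n a (a + L)) O
          ≤ base⁻¹ * condVar H β (interval n a (a + L)) O := by gcongr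
        _ ≤ base⁻¹ * (base * E) := by
          have := h1.trans (mul_le_mul_of_nonneg_right h2 hE)
          gcongr
        _ = E := by field_simp
    · obtain ⟨b, s, hb, hs, hbL, hsL, hcb, hKx, hs', hε⟩ := hL₀ L (by omega)
      set x := Real.log L with hx
      have hx0 : 0 < x := by linarith
      have hL6 : (6 : ℝ) ≤ L := by exact_mod_cast (show 6 ≤ L by omega)
      have hdx : d < x := Real.log_lt_log (by norm_num) (by linarith)
      have hxd : Real.log (3 / 4 * L) = x - d := by
        rw [show (3 / 4 : ℝ) * L = L / (4 / 3) by ring, Real.log_div (by linarith) (by norm_num)]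
      have hxd0 : 0 < x - d := by linarith
      have hlam' : 0 ≤ lam₀ * (x - d) ^ (-c) := by positivity
      have hstep := condVar_interval_le_of_scale H hSC haL hb hbL hsL hcb hlam' O (by
        intro y z hyz hz hzL
        have h1 := ih (z - y) (by omega) y (by omega) (by omega)
        rw [Nat.add_sub_cancel' (by omega : y ≤ z)] at h1
        refine le_trans ?_ h1
        refine mul_le_mul_of_nonneg_right ?_ (condVar_nonneg H β _ O)
        refine mul_le_mul_of_nonneg_left ?_ hlam0.le
        have h2 : (2 : ℝ) ≤ (z - y : ℕ) := by exact_mod_cast (show 2 ≤ z - y by omega)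
        have h3 : ((z - y : ℕ) : ℝ) ≤ 3 / 4 * L := by
          have : (4 : ℝ) * (z - y : ℕ) ≤ 3 * L := by exact_mod_cast hzL
          linarith
        refine Real.rpow_le_rpow_of_nonpos (Real.log_pos (by linarith)) ?_ (by linarith)
        rw [← hxd]
        exact Real.log_le_log (by linarith) h3)
      set ε := c₁ * Real.exp (-((b : ℝ) ^ c₂))
      have hs0 : (0 : ℝ) < s := by exact_mod_cast hs
      have hrp := rpow_neg_le_mul_rpow_neg hK0 hd0 hKx hdx
      -- `(1 - K / x) (1 + 1 / s) ≤ 1 - 2 ε`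
      have hloss : (1 - K / x) * (s + 1) ≤ (1 - 2 * ε) * s := by
        have h1 : K / x = 1 / x + 8 * (c₃ + 1) / x := by rw [hK, add_div]
        have h2 : 0 ≤ 1 / x := by positivity
        have h3 : 0 ≤ 8 * (c₃ + 1) / x := by positivity
        have h4 : 1 ≤ 8 * (c₃ + 1) / x * s := by
          rwa [div_le_iff₀ hs0] at hs'
        rw [h1]
        nlinarith
      have h5 : (s + 1 : ℝ) * (lam₀ * x ^ (-c) * condVar H β (interval n a (a + L)) O)
          ≤ (s + 1) * E := by
        refine le_trans ?_ hstep
        calc (s + 1 : ℝ) * (lam₀ * x ^ (-c) * condVar H β (interval n a (a + L)) O)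
            ≤ (s + 1) * (lam₀ * ((x - d) ^ (-c) * (1 - K / x)) *
                condVar H β (interval n a (a + L)) O) := by gcongr
          _ = lam₀ * (x - d) ^ (-c) * ((1 - K / x) * (s + 1)) *
                condVar H β (interval n a (a + L)) O := by ring
          _ ≤ lam₀ * (x - d) ^ (-c) * ((1 - 2 * ε) * s) *
                condVar H β (interval n a (a + L)) O := by gcongr
          _ = _ := by ring
      exact le_of_mul_le_mul_left h5 (by positivity)

end SpinChain

theorem mainTheorem8 (q : ℕ) (β : ℝ) (hβ : 0 ≤ β) (c₁ c₂ c₃ : ℝ)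
    (hc₁ : 0 < c₁) (hc₂ : 0 < c₂) (hc₃ : 0 < c₃) :
    ∃ (ℓ₀ : ℕ) (lam₀ c : ℝ), 2 ≤ ℓ₀ ∧ 0 < lam₀ ∧ 0 < c ∧
      ∀ (n : ℕ) (H : SpinChain.Hamiltonian1D n q),
        SpinChain.StrongClustering H β c₁ c₂ c₃ →
        ∀ R : Finset (Fin n), SpinChain.IsInterval R → ℓ₀ ≤ R.card →
          ((lam₀ * (1 / Real.log (R.card : ℝ) ^ c) : ℝ) : EReal) ≤ SpinChain.condGap H β R := by
  obtain ⟨lam₀, c, hlam₀, hc, h⟩ := SpinChain.exists_condVar_interval_le q hβ hc₁ hc₂ hc₃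
  refine ⟨2, lam₀, c, le_rfl, hlam₀, hc, ?_⟩
  rintro n H hSC R ⟨a, b, hab, hbn, rfl⟩ hR
  refine le_iInf₂ fun X hX => ?_
  rw [EReal.coe_le_coe_iff, SpinChain.kmsInner_neg_generator,
    le_div_iff₀ (lt_of_le_of_ne (SpinChain.condVar_nonneg H β _ X) (Ne.symm hX))]
  rw [SpinChain.card_interval hbn] at hR ⊢
  have h1 := h n H hSC X (b - a) a hR (by omega)
  rw [Nat.add_sub_cancel' hab.le] at h1
  have hlog : 0 ≤ Real.log ((b - a : ℕ) : ℝ) := Real.log_natCast_nonneg _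
  rw [one_div, ← Real.rpow_neg hlog]
  exact h1
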